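/- Let $M$ and $N$ be smooth Hausdorff Banach manifolds (without boundary) modelled on Banach spaces $E$ and $E'$, and let $p\colon M\to N$ be a surjective submersion: around every $m\in M$ and around $p(m)$ there are charts in which $p$ becomes the projection $E\cong E'\times F\to E'$, for a fixed typical complement $F$ (the existence of a common $F$ is automatic if $M$ is connected). Then each fibre $M_x=p^{-1}(x)$, $x\in N$, is a submanifold of $M$ modelled on $F$, with inclusion $\iota_x\colon M_x\to M$; the fibre product $M\times_pM=\{(m,m')\in M\times M : p(m)=p(m')\}$ is a submanifold of $M\times M$; and the vertical bundle $\pi_{\mathcal V}\colon\mathcal V=\ker Tp\to M$ is a smooth Banach vector bundle with typical fibre $F$, anchored by the inclusion $\rho\colon\mathcal V\to TM$. The map $T\iota_x$ takes values in $\mathcal V$. A spray on a Banach vector bundle $\pi\colon A\to B$ over a Banach manifold $B$ with anchor $\rho\colon A\to TB$ is a smooth vector field $S\colon A\to TA$ such that $T\pi\circ S=\rho$ and $S\circ h_\lambda=Th_\lambda(\lambda S)$ for all $\lambda\in\mathbb R$, where $h_\lambda$ is fibrewise multiplication by $\lambda$; a spray on a manifold $B$ is a spray on $TB$ with anchor $\mathrm{id}_{TB}$.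 Its exponential map is $\exp_S=\pi\circ\mathrm{Fl}^S_1$, defined at those $v\in A$ for which the flow $\mathrm{Fl}^S_t(v)$ of $S$ exists up to time $1$. (a) Let $S$ be a spray on $(\pi_{\mathcal V},\mathcal V,\rho)$. For every $x\in N$ there is a unique spray $S_x\colon TM_x\to T^2M_x$ on the manifold $M_x$ that is $T\iota_x$-related to $S$, i.e. $T(T\iota_x)\circ S_x=S\circ T\iota_x$. (b) Suppose that $M$ is $C^\infty$-paracompact, i.e. paracompact and such that every open cover has a subordinate smooth partition of unity. Then there exists a spray on $(\pi_{\mathcal V},\mathcal V,\rho)$, and for every such spray $S$ there is an open neighbourhood $U\subseteq\mathcal V$ of the zero section on which $\exp_S$ is defined such that $\Psi=(\pi_{\mathcal V},\exp_S)|_U$ is a local addition on $p$: $\Psi$ is an open embedding (a diffeomorphism onto an open subset) of $U$ into $M\times_pM$ with $\Psi(0_m)=(m,m)$ for all $m\in M$ and $\mathrm{pr}_1\circ\Psi=\pi_{\mathcal V}|_U$. In particular, there exists a local addition on $p$. -/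

import Mathlib

open Set Function Manifold Bundle Topology
open scoped Manifold ContDiff Bundle

noncomputable section

namespace Spray

/-! ### Splitting submanifolds -/

section Submanifold

variable {B : Type*} [NormedAddCommGroup B] [NormedSpace ℝ B] {H : Type*} [TopologicalSpace H]
  (I : ModelWithCorners ℝ B H) {X : Type*} [TopologicalSpace X] [ChartedSpace H X]
  (G : Type*) [NormedAddCommGroup G] [NormedSpace ℝ G]

/-- A chart, with values in `G`, of a subset `A` of a manifold `X`: a smooth map `toFun` on an open
subset `dom` of `X` which restricts to a bijection from `A ∩ dom` onto an open subset `cod` of `G`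
whose inverse `invFun` is smooth as a map into `X`. -/
structure SubmanifoldChart (A : Set X) where
  dom : Set X
  cod : Set G
  toFun : X → G
  invFun : G → X
  isOpen_dom : IsOpen dom
  isOpen_cod : IsOpen cod
  mapsTo : ∀ y ∈ A, y ∈ dom → toFun y ∈ cod
  invFun_mem : ∀ g ∈ cod, invFun g ∈ A
  invFun_mem_dom : ∀ g ∈ cod, invFun g ∈ dom
  left_inv : ∀ y ∈ A, y ∈ dom → invFun (toFun y) = y
  right_inv : ∀ g ∈ cod, toFun (invFun g) = g
  contMDiffOn_toFun : ContMDiffOn I 𝓘(ℝ, G) ∞ toFun dom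
  contMDiffOn_invFun : ContMDiffOn 𝓘(ℝ, G) I ∞ invFun cod

variable {I G}

open Classical in
/-- The chart of the topological space `A` given by a `SubmanifoldChart`; the point `a` only
provides the irrelevant values of the inverse outside of the target. -/
def SubmanifoldChart.chart {A : Set X} (c : SubmanifoldChart I G A) (a : A) :
    OpenPartialHomeomorph A G where
  toFun y := c.toFun y
  invFun g := if h : g ∈ c.cod then ⟨c.invFun g, c.invFun_mem g h⟩ else a
  source := {y : A | (y : X) ∈ c.dom}
  target := c.cod
  map_source' y hy := c.mapsTo y y.2 hy
  map_target' g hg := by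
    simp only [dif_pos hg]
    exact c.invFun_mem_dom g hg
  left_inv' y hy := by
    simp only [dif_pos (c.mapsTo y y.2 hy)]
    exact Subtype.ext (c.left_inv y y.2 hy)
  right_inv' g hg := by
    simp only [dif_pos hg]
    exact c.right_inv g hg
  open_source := c.isOpen_dom.preimage continuous_subtype_val
  open_target := c.isOpen_cod
  continuousOn_toFun := c.contMDiffOn_toFun.continuousOn.comp
    continuous_subtype_val.continuousOn fun _ h ↦ h
  continuousOn_invFun := by
    rw [IsInducing.subtypeVal.continuousOn_iff]
    refine c.contMDiffOn_invFun.continuousOn.congr fun g hg ↦ ?_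
    simp [dif_pos hg]

open Classical in
theorem SubmanifoldChart.val_chart_symm {A : Set X} (c : SubmanifoldChart I G A) (a : A) {g : G}
    (hg : g ∈ c.cod) : (((c.chart a).symm g : A) : X) = c.invFun g := by
  change ((if h : g ∈ c.cod then (⟨c.invFun g, c.invFun_mem g h⟩ : A) else a : A) : X) = _
  rw [dif_pos hg]

/-- The atlas on `A` given by a submanifold chart around every point. -/
abbrev submanifoldChartedSpace {A : Set X} (c : A → SubmanifoldChart I G A)
    (hc : ∀ a : A, (a : X) ∈ (c a).dom) : ChartedSpace G A where
  atlas := range fun a ↦ (c a).chart a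
  chartAt a := (c a).chart a
  mem_chart_source a := hc a
  chart_mem_atlas a := mem_range_self a

theorem submanifold_isManifold {A : Set X} (c : A → SubmanifoldChart I G A)
    (hc : ∀ a : A, (a : X) ∈ (c a).dom) :
    letI := submanifoldChartedSpace c hc
    IsManifold 𝓘(ℝ, G) ∞ A := by
  let := submanifoldChartedSpace c hc
  apply isManifold_of_contDiffOn
  rintro _ _ ⟨a, rfl⟩ ⟨b, rfl⟩
  rw [← contMDiffOn_iff_contDiffOn]
  have h : ContMDiffOn 𝓘(ℝ, G) 𝓘(ℝ, G) ∞ ((c b).toFun ∘ (c a).invFun)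
      ((c a).cod ∩ (c a).invFun ⁻¹' (c b).dom) :=
    (c b).contMDiffOn_toFun.comp ((c a).contMDiffOn_invFun.mono inter_subset_left)
      fun _ h ↦ h.2
  have key : ∀ g ∈ 𝓘(ℝ, G).symm ⁻¹' (((c a).chart a).symm ≫ₕ (c b).chart b).source ∩
      range 𝓘(ℝ, G), g ∈ (c a).cod ∧ (((c a).chart a).symm g : X) ∈ (c b).dom := by
    rintro g ⟨hg, -⟩
    simpa using! hg
  refine (h.mono fun g hg ↦ ?_).congr fun g hg ↦ ?_
  · obtain ⟨h1, h2⟩ := key g hg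
    rw [SubmanifoldChart.val_chart_symm _ _ h1] at h2
    exact ⟨h1, h2⟩
  · obtain ⟨h1, h2⟩ := key g hg
    change (c b).toFun (((c a).chart a).symm g : X) = _
    rw [SubmanifoldChart.val_chart_symm _ _ h1]
    rfl

theorem submanifold_contMDiff_val {A : Set X} (c : A → SubmanifoldChart I G A)
    (hc : ∀ a : A, (a : X) ∈ (c a).dom) :
    letI := submanifoldChartedSpace c hc
    ContMDiff 𝓘(ℝ, G) I ∞ (Subtype.val : A → X) := by
  let := submanifoldChartedSpace c hc
  have := submanifold_isManifold c hc
  intro a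
  have h1 : ContMDiffAt 𝓘(ℝ, G) 𝓘(ℝ, G) ∞ (chartAt G a) a :=
    contMDiffAt_of_mem_maximalAtlas (IsManifold.chart_mem_maximalAtlas a) (mem_chart_source G a)
  have h2 : ContMDiffAt 𝓘(ℝ, G) I ∞ (c a).invFun (chartAt G a a) :=
    (c a).contMDiffOn_invFun.contMDiffAt
      ((c a).isOpen_cod.mem_nhds ((c a).mapsTo a a.2 (hc a)))
  refine (h2.comp a h1).congr_of_eventuallyEq ?_
  filter_upwards [(chartAt G a).open_source.mem_nhds (mem_chart_source G a)] with y hy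
  exact ((c a).left_inv y y.2 hy).symm

end Submanifold

/-! ### Fibres, fibre product and vertical bundle of a submersion -/

section Submersion

variable {E E' F : Type*} [NormedAddCommGroup E] [NormedSpace ℝ E]
  [NormedAddCommGroup E'] [NormedSpace ℝ E'] [NormedAddCommGroup F] [NormedSpace ℝ F]
  {M N : Type*} [TopologicalSpace M] [ChartedSpace E M] [TopologicalSpace N] [ChartedSpace E' N]
  {p : M → N}

theorem submersion_chart_eq {m : M}
    (h : IsSubmersionAtOfComplement F 𝓘(ℝ, E) 𝓘(ℝ, E') ∞ p m) {y : M} (hy : y ∈ h.domChart.source) :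
    (h.equiv (h.domChart y)).1 = h.codChart (p y) := by
  have ht : h.domChart y ∈ (h.domChart.extend 𝓘(ℝ, E)).target := by
    simpa using h.domChart.map_source hy
  have := h.writtenInCharts ht
  simpa [h.domChart.left_inv hy] using this.symm

/-- In submersion charts around `m`, the fibre through `m` has the coordinate in `F` as chart. -/
def fibreChart (hp : IsSubmersionOfComplement F 𝓘(ℝ, E) 𝓘(ℝ, E') ∞ p) (x : N)
    (m : p ⁻¹' {x}) : SubmanifoldChart 𝓘(ℝ, E) F (p ⁻¹' {x}) where
  dom := (hp m).domChart.source
  cod := (fun b : F ↦ (hp m).equiv.symm ((hp m).codChart x, b)) ⁻¹' (hp m).domChart.target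
  toFun y := ((hp m).equiv ((hp m).domChart y)).2
  invFun b := (hp m).domChart.symm ((hp m).equiv.symm ((hp m).codChart x, b))
  isOpen_dom := (hp m).domChart.open_source
  isOpen_cod := (hp m).domChart.open_target.preimage (by fun_prop)
  mapsTo y hy hd := by
    have h : (hp m).codChart x = ((hp m).equiv ((hp m).domChart y)).1 := by
      rw [submersion_chart_eq (hp m) hd, hy]
    simpa [h] using (hp m).domChart.map_source hd
  invFun_mem b hb := by
    have hs := (hp m).domChart.map_target hb
    have h := submersion_chart_eq (hp m) hs
    rw [(hp m).domChart.right_inv hb] at h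
    refine ((hp m).codChart.injOn ?_ ((hp m).source_subset_preimage_source hs) ?_).symm
    · have := (hp m).mem_codChart_source
      rwa [show p m = x from m.2] at this
    · simpa using h
  invFun_mem_dom b hb := (hp m).domChart.map_target hb
  left_inv y hy hd := by
    have h : (hp m).codChart x = ((hp m).equiv ((hp m).domChart y)).1 := by
      rw [submersion_chart_eq (hp m) hd, hy]
    simp [h, (hp m).domChart.left_inv hd]
  right_inv b hb := by simp [(hp m).domChart.right_inv hb]
  contMDiffOn_toFun := by
    have h1 : ContDiff ℝ ∞ fun e : E ↦ ((hp m).equiv e).2 := by fun_prop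
    exact h1.contMDiff.comp_contMDiffOn
      (contMDiffOn_of_mem_maximalAtlas (hp m).domChart_mem_maximalAtlas)
  contMDiffOn_invFun := by
    have h1 : ContDiff ℝ ∞ fun b : F ↦ (hp m).equiv.symm ((hp m).codChart x, b) := by fun_prop
    exact (contMDiffOn_symm_of_mem_maximalAtlas (hp m).domChart_mem_maximalAtlas).comp
      h1.contMDiff.contMDiffOn fun _ h ↦ h

/-- The fibre `p ⁻¹ (x)` of a submersion `p`, a manifold modelled on `F`. -/
def Fibre (_hp : IsSubmersionOfComplement F 𝓘(ℝ, E) 𝓘(ℝ, E') ∞ p) (x : N) : Type _ :=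
  ↥(p ⁻¹' {x})

instance (hp : IsSubmersionOfComplement F 𝓘(ℝ, E) 𝓘(ℝ, E') ∞ p) (x : N) :
    TopologicalSpace (Fibre hp x) :=
  inferInstanceAs (TopologicalSpace ↥(p ⁻¹' {x}))

instance (hp : IsSubmersionOfComplement F 𝓘(ℝ, E) 𝓘(ℝ, E') ∞ p) (x : N) :
    ChartedSpace F (Fibre hp x) :=
  submanifoldChartedSpace (fibreChart hp x) fun m ↦ (hp m).mem_domChart_source

instance (hp : IsSubmersionOfComplement F 𝓘(ℝ, E) 𝓘(ℝ, E') ∞ p) (x : N) :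
    IsManifold 𝓘(ℝ, F) ∞ (Fibre hp x) :=
  submanifold_isManifold (fibreChart hp x) fun m ↦ (hp m).mem_domChart_source

/-- The inclusion of a fibre. -/
def fibreIncl (hp : IsSubmersionOfComplement F 𝓘(ℝ, E) 𝓘(ℝ, E') ∞ p) (x : N) :
    Fibre hp x → M :=
  Subtype.val

theorem contMDiff_fibreIncl (hp : IsSubmersionOfComplement F 𝓘(ℝ, E) 𝓘(ℝ, E') ∞ p) (x : N) :
    ContMDiff 𝓘(ℝ, F) 𝓘(ℝ, E) ∞ (fibreIncl hp x) :=
  submanifold_contMDiff_val (fibreChart hp x) fun m ↦ (hp m).mem_domChart_source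

/-- Around `(m₁, m₂)`, the fibre product has as chart the coordinate in `E` of the first point and
the coordinate in `F` of the second point, with respect to submersion charts around `m₁`, `m₂`. -/
def fibreProductChart (hp : IsSubmersionOfComplement F 𝓘(ℝ, E) 𝓘(ℝ, E') ∞ p)
    (q : {q : M × M | p q.1 = p q.2}) :
    SubmanifoldChart (𝓘(ℝ, E).prod 𝓘(ℝ, E)) (E × F) {q : M × M | p q.1 = p q.2} where
  dom := (hp q.1.1).domChart.source ×ˢ (hp q.1.2).domChart.source
  cod := {g : E × F | (g.1 ∈ (hp q.1.1).domChart.target ∧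
      p ((hp q.1.1).domChart.symm g.1) ∈ (hp q.1.2).codChart.source) ∧
    (hp q.1.2).equiv.symm ((hp q.1.2).codChart (p ((hp q.1.1).domChart.symm g.1)), g.2) ∈
      (hp q.1.2).domChart.target}
  toFun y := ((hp q.1.1).domChart y.1, ((hp q.1.2).equiv ((hp q.1.2).domChart y.2)).2)
  invFun g := ((hp q.1.1).domChart.symm g.1, (hp q.1.2).domChart.symm
    ((hp q.1.2).equiv.symm ((hp q.1.2).codChart (p ((hp q.1.1).domChart.symm g.1)), g.2)))
  isOpen_dom := (hp q.1.1).domChart.open_source.prod (hp q.1.2).domChart.open_source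
  isOpen_cod := by
    have h1 : IsOpen {e : E | e ∈ (hp q.1.1).domChart.target ∧
        p ((hp q.1.1).domChart.symm e) ∈ (hp q.1.2).codChart.source} :=
      (hp.contMDiff.continuous.comp_continuousOn
        (hp q.1.1).domChart.continuousOn_symm).isOpen_inter_preimage
          (hp q.1.1).domChart.open_target (hp q.1.2).codChart.open_source
    have h2 : ContinuousOn (fun g : E × F ↦ (hp q.1.2).equiv.symm
        ((hp q.1.2).codChart (p ((hp q.1.1).domChart.symm g.1)), g.2))
        {g : E × F | g.1 ∈ (hp q.1.1).domChart.target ∧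
          p ((hp q.1.1).domChart.symm g.1) ∈ (hp q.1.2).codChart.source} := by
      refine (hp q.1.2).equiv.symm.continuous.comp_continuousOn
        (ContinuousOn.prodMk ?_ continuousOn_snd)
      refine (hp q.1.2).codChart.continuousOn.comp (hp.contMDiff.continuous.comp_continuousOn
        ((hp q.1.1).domChart.continuousOn_symm.comp continuousOn_fst fun _ h ↦ h.1)) ?_
      exact fun _ h ↦ h.2
    exact h2.isOpen_inter_preimage (h1.preimage continuous_fst) (hp q.1.2).domChart.open_target
  mapsTo y hy hd := by
    have hy' : p y.1 = p y.2 := hy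
    refine ⟨⟨(hp q.1.1).domChart.map_source hd.1, ?_⟩, ?_⟩
    · simp only [(hp q.1.1).domChart.left_inv hd.1, hy']
      exact (hp q.1.2).source_subset_preimage_source hd.2
    · simp only [(hp q.1.1).domChart.left_inv hd.1, hy',
        ← submersion_chart_eq (hp q.1.2) hd.2, Prod.mk.eta,
        ContinuousLinearEquiv.symm_apply_apply]
      exact (hp q.1.2).domChart.map_source hd.2
  invFun_mem g hg := by
    have hs := (hp q.1.2).domChart.map_target hg.2
    have h := submersion_chart_eq (hp q.1.2) hs
    rw [(hp q.1.2).domChart.right_inv hg.2] at h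
    refine (hp q.1.2).codChart.injOn hg.1.2 ((hp q.1.2).source_subset_preimage_source hs) ?_
    simpa using h
  invFun_mem_dom g hg :=
    ⟨(hp q.1.1).domChart.map_target hg.1.1, (hp q.1.2).domChart.map_target hg.2⟩
  left_inv y hy hd := by
    have hy' : p y.1 = p y.2 := hy
    simp [(hp q.1.1).domChart.left_inv hd.1, hy', ← submersion_chart_eq (hp q.1.2) hd.2,
      (hp q.1.2).domChart.left_inv hd.2]
  right_inv g hg := by
    simp [(hp q.1.1).domChart.right_inv hg.1.1, (hp q.1.2).domChart.right_inv hg.2]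
  contMDiffOn_toFun := by
    have h1 : ContDiff ℝ ∞ fun e : E ↦ ((hp q.1.2).equiv e).2 := by fun_prop
    exact ((contMDiffOn_of_mem_maximalAtlas (hp q.1.1).domChart_mem_maximalAtlas).comp
      contMDiffOn_fst fun _ h ↦ h.1).prodMk_space
      (h1.contMDiff.comp_contMDiffOn
        ((contMDiffOn_of_mem_maximalAtlas (hp q.1.2).domChart_mem_maximalAtlas).comp
          contMDiffOn_snd fun _ h ↦ h.2))
  contMDiffOn_invFun := by
    have h0 : ContMDiff 𝓘(ℝ, E × F) 𝓘(ℝ, E) ∞ (Prod.fst : E × F → E) := contDiff_fst.contMDiff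
    have h0' : ContMDiff 𝓘(ℝ, E × F) 𝓘(ℝ, F) ∞ (Prod.snd : E × F → F) := contDiff_snd.contMDiff
    have h1 := (contMDiffOn_symm_of_mem_maximalAtlas
      (hp q.1.1).domChart_mem_maximalAtlas).comp (h0.contMDiffOn (s := {g : E × F |
        (g.1 ∈ (hp q.1.1).domChart.target ∧
          p ((hp q.1.1).domChart.symm g.1) ∈ (hp q.1.2).codChart.source) ∧
        (hp q.1.2).equiv.symm ((hp q.1.2).codChart (p ((hp q.1.1).domChart.symm g.1)), g.2) ∈
          (hp q.1.2).domChart.target})) fun _ h ↦ h.1.1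
    refine h1.prodMk ?_
    have h2 := (contMDiffOn_of_mem_maximalAtlas (hp q.1.2).codChart_mem_maximalAtlas).comp
      (hp.contMDiff.comp_contMDiffOn h1) fun _ h ↦ h.1.2
    have h3 := (hp q.1.2).equiv.symm.contDiff (n := ∞) |>.contMDiff.comp_contMDiffOn
      (h2.prodMk_space h0'.contMDiffOn)
    exact (contMDiffOn_symm_of_mem_maximalAtlas (hp q.1.2).domChart_mem_maximalAtlas).comp
      h3 fun _ h ↦ h.2

/-- The fibre product `M ×_p M` of a submersion `p`, a manifold modelled on `E × F`. -/
def FibreProduct (_hp : IsSubmersionOfComplement F 𝓘(ℝ, E) 𝓘(ℝ, E') ∞ p) : Type _ :=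
  ↥{q : M × M | p q.1 = p q.2}

instance (hp : IsSubmersionOfComplement F 𝓘(ℝ, E) 𝓘(ℝ, E') ∞ p) :
    TopologicalSpace (FibreProduct hp) :=
  inferInstanceAs (TopologicalSpace ↥{q : M × M | p q.1 = p q.2})

instance (hp : IsSubmersionOfComplement F 𝓘(ℝ, E) 𝓘(ℝ, E') ∞ p) :
    ChartedSpace (E × F) (FibreProduct hp) :=
  submanifoldChartedSpace (fibreProductChart hp) fun q ↦
    ⟨(hp q.1.1).mem_domChart_source, (hp q.1.2).mem_domChart_source⟩

instance (hp : IsSubmersionOfComplement F 𝓘(ℝ, E) 𝓘(ℝ, E') ∞ p) :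
    IsManifold 𝓘(ℝ, E × F) ∞ (FibreProduct hp) :=
  submanifold_isManifold (fibreProductChart hp) fun q ↦
    ⟨(hp q.1.1).mem_domChart_source, (hp q.1.2).mem_domChart_source⟩

/-- The first projection of the fibre product. -/
def FibreProduct.fst {hp : IsSubmersionOfComplement F 𝓘(ℝ, E) 𝓘(ℝ, E') ∞ p}
    (q : FibreProduct hp) : M :=
  q.1.1

/-- The second projection of the fibre product. -/
def FibreProduct.snd {hp : IsSubmersionOfComplement F 𝓘(ℝ, E) 𝓘(ℝ, E') ∞ p}
    (q : FibreProduct hp) : M :=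
  q.1.2

/-- The vertical space at `m`: the kernel of `T_m p`. -/
def Vertical (_hp : IsSubmersionOfComplement F 𝓘(ℝ, E) 𝓘(ℝ, E') ∞ p) (m : M) : Type _ :=
  ↥(mfderiv 𝓘(ℝ, E) 𝓘(ℝ, E') p m).ker

section

variable (hp : IsSubmersionOfComplement F 𝓘(ℝ, E) 𝓘(ℝ, E') ∞ p)

instance (m : M) : AddCommGroup (Vertical hp m) :=
  inferInstanceAs (AddCommGroup ↥(mfderiv 𝓘(ℝ, E) 𝓘(ℝ, E') p m).ker)

instance (m : M) : Module ℝ (Vertical hp m) :=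
  inferInstanceAs (Module ℝ ↥(mfderiv 𝓘(ℝ, E) 𝓘(ℝ, E') p m).ker)

instance (m : M) : TopologicalSpace (Vertical hp m) :=
  inferInstanceAs (TopologicalSpace ↥(mfderiv 𝓘(ℝ, E) 𝓘(ℝ, E') p m).ker)

/-- The inclusion of the vertical space into the tangent space. -/
def verticalIncl (m : M) : Vertical hp m →L[ℝ] TangentSpace 𝓘(ℝ, E) m :=
  (mfderiv 𝓘(ℝ, E) 𝓘(ℝ, E') p m).ker.subtypeL

theorem mdifferentiableAt_domChart (m : M) {y : M} (hy : y ∈ (hp m).domChart.source) :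
    MDifferentiableAt 𝓘(ℝ, E) 𝓘(ℝ, E) (hp m).domChart y :=
  (contMDiffAt_of_mem_maximalAtlas (hp m).domChart_mem_maximalAtlas hy).mdifferentiableAt
    (by simp)

theorem mdifferentiableAt_domChart_symm (m : M) {g : E} (hg : g ∈ (hp m).domChart.target) :
    MDifferentiableAt 𝓘(ℝ, E) 𝓘(ℝ, E) (hp m).domChart.symm g :=
  (contMDiffAt_symm_of_mem_maximalAtlas (hp m).domChart_mem_maximalAtlas hg).mdifferentiableAt
    (by simp)

theorem mdifferentiable_domChart (m : M) :
    (hp m).domChart.MDifferentiable 𝓘(ℝ, E) 𝓘(ℝ, E) :=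
  ⟨fun _ hy ↦ (mdifferentiableAt_domChart hp m hy).mdifferentiableWithinAt,
    fun _ hy ↦ (mdifferentiableAt_domChart_symm hp m hy).mdifferentiableWithinAt⟩

/-- In submersion charts, the vertical vectors are those whose component in `E'` vanishes. -/
theorem mem_vertical_iff (m : M) {y : M} (hy : y ∈ (hp m).domChart.source)
    (v : TangentSpace 𝓘(ℝ, E) y) :
    mfderiv 𝓘(ℝ, E) 𝓘(ℝ, E') p y v = 0 ↔
      ((hp m).equiv (mfderiv 𝓘(ℝ, E) 𝓘(ℝ, E) (hp m).domChart y v : E)).1 = 0 := by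
  have hpy := (hp m).source_subset_preimage_source hy
  have hc : (hp m).codChart.MDifferentiable 𝓘(ℝ, E') 𝓘(ℝ, E') :=
    ⟨fun _ h ↦ ((contMDiffAt_of_mem_maximalAtlas (hp m).codChart_mem_maximalAtlas
      h).mdifferentiableAt (by simp)).mdifferentiableWithinAt,
    fun _ h ↦ ((contMDiffAt_symm_of_mem_maximalAtlas (hp m).codChart_mem_maximalAtlas
      h).mdifferentiableAt (by simp)).mdifferentiableWithinAt⟩
  have hpd : MDifferentiableAt 𝓘(ℝ, E) 𝓘(ℝ, E') p y :=
    (hp.contMDiff y).mdifferentiableAt (by simp)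
  have hφ := mdifferentiableAt_domChart hp m hy
  have h1 : HasMFDerivAt 𝓘(ℝ, E) 𝓘(ℝ, E') ((hp m).codChart ∘ p) y
      ((mfderiv 𝓘(ℝ, E') 𝓘(ℝ, E') (hp m).codChart (p y)).comp
        (mfderiv 𝓘(ℝ, E) 𝓘(ℝ, E') p y)) :=
    (hc.mdifferentiableAt hpy).hasMFDerivAt.comp y hpd.hasMFDerivAt
  let L : E →L[ℝ] E' := (ContinuousLinearMap.fst ℝ E' F).comp
    ((hp m).equiv : E →L[ℝ] E' × F)
  have h2 : HasMFDerivAt 𝓘(ℝ, E) 𝓘(ℝ, E') (L ∘ (hp m).domChart) y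
      (L.comp (mfderiv 𝓘(ℝ, E) 𝓘(ℝ, E) (hp m).domChart y)) :=
    L.hasMFDerivAt.comp y hφ.hasMFDerivAt
  have h3 : (hp m).codChart ∘ p =ᶠ[𝓝 y] L ∘ (hp m).domChart := by
    filter_upwards [(hp m).domChart.open_source.mem_nhds hy] with z hz
    exact (submersion_chart_eq (hp m) hz).symm
  have h4 := hasMFDerivAt_unique h1 (h2.congr_of_eventuallyEq h3)
  have h5 : mfderiv 𝓘(ℝ, E') 𝓘(ℝ, E') (hp m).codChart (p y) (mfderiv 𝓘(ℝ, E) 𝓘(ℝ, E') p y v) =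
      ((hp m).equiv (mfderiv 𝓘(ℝ, E) 𝓘(ℝ, E) (hp m).domChart y v : E)).1 :=
    DFunLike.congr_fun h4 v
  rw [← h5]
  exact (map_eq_zero_iff _ (hc.mfderiv_injective hpy)).symm

/-- The tangent map at `y` of the submersion chart around `m`. -/
def chartDeriv (m : M) {y : M} (hy : y ∈ (hp m).domChart.source) :
    TangentSpace 𝓘(ℝ, E) y ≃L[ℝ] E' × F :=
  ContinuousLinearEquiv.trans (M₂ := E) ((mdifferentiable_domChart hp m).mfderiv hy) (hp m).equiv

theorem chartDeriv_apply (m : M) {y : M} (hy : y ∈ (hp m).domChart.source)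
    (v : TangentSpace 𝓘(ℝ, E) y) :
    chartDeriv hp m hy v =
      (hp m).equiv (mfderiv 𝓘(ℝ, E) 𝓘(ℝ, E) (hp m).domChart y v : E) := rfl

theorem chartDeriv_symm_mem (m : M) {y : M} (hy : y ∈ (hp m).domChart.source) (w : F) :
    (chartDeriv hp m hy).symm (0, w) ∈ (mfderiv 𝓘(ℝ, E) 𝓘(ℝ, E') p y).ker := by
  refine (mem_vertical_iff hp m hy _).2 ?_
  rw [← chartDeriv_apply hp m hy, ContinuousLinearEquiv.apply_symm_apply]

/-- Over the domain of a submersion chart `φ` around `m`, the vertical space at `y` is identified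
with `F` by taking a vertical vector `v` to the component of `Tφ (v)` in `F`. -/
def verticalEquiv (m : M) {y : M} (hy : y ∈ (hp m).domChart.source) :
    Vertical hp y ≃L[ℝ] F where
  toFun v := (chartDeriv hp m hy (verticalIncl hp y v)).2
  invFun w := ⟨(chartDeriv hp m hy).symm (0, w), chartDeriv_symm_mem hp m hy w⟩
  map_add' v w := by simp
  map_smul' a v := by simp
  left_inv v := by
    have h : (chartDeriv hp m hy (verticalIncl hp y v)).1 = 0 :=
      (mem_vertical_iff hp m hy _).1 v.2
    refine Subtype.ext ?_
    change (chartDeriv hp m hy).symm (0, (chartDeriv hp m hy (verticalIncl hp y v)).2) = _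
    rw [← h, Prod.mk.eta, ContinuousLinearEquiv.symm_apply_apply]
    rfl
  right_inv w := by
    change (chartDeriv hp m hy ((chartDeriv hp m hy).symm (0, w))).2 = w
    rw [ContinuousLinearEquiv.apply_symm_apply]
  continuous_toFun := by
    fun_prop
  continuous_invFun := by
    refine Continuous.subtype_mk ?_ _
    fun_prop

/-- The bundle coordinates of a vertical vector with respect to the submersion chart around `m`. -/
def verticalCoord (m : M) (v : TotalSpace F (Vertical hp)) : M × F :=
  (v.1, ((hp m).equiv
    (mfderiv 𝓘(ℝ, E) 𝓘(ℝ, E) (hp m).domChart v.1 (verticalIncl hp v.1 v.2) : E)).2)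

open Classical in
/-- The trivialisation of the vertical bundle over the domain of a submersion chart. -/
def verticalPretrivialization (m : M) : Pretrivialization F (π F (Vertical hp)) where
  toFun := verticalCoord hp m
  invFun w := if h : w.1 ∈ (hp m).domChart.source then ⟨w.1, (verticalEquiv hp m h).symm w.2⟩
    else ⟨w.1, 0⟩
  source := π F (Vertical hp) ⁻¹' (hp m).domChart.source
  target := (hp m).domChart.source ×ˢ univ
  map_source' v hv := ⟨hv, mem_univ _⟩
  map_target' w hw := by
    rw [dif_pos hw.1]
    exact hw.1
  left_inv' v hv := by
    have hv' : v.1 ∈ (hp m).domChart.source := hv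
    refine (dif_pos hv').trans ?_
    obtain ⟨b, v⟩ := v
    congr 1
    exact (verticalEquiv hp m hv').symm_apply_apply v
  right_inv' w hw := by
    have hw' : w.1 ∈ (hp m).domChart.source := hw.1
    rw [dif_pos hw']
    exact Prod.ext rfl ((verticalEquiv hp m hw').apply_symm_apply w.2)
  open_target := (hp m).domChart.open_source.prod isOpen_univ
  baseSet := (hp m).domChart.source
  open_baseSet := (hp m).domChart.open_source
  source_eq := rfl
  target_eq := rfl
  proj_toFun _ _ := rfl

theorem verticalPretrivialization_apply (m : M) {y : M} (hy : y ∈ (hp m).domChart.source)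
    (v : Vertical hp y) :
    (verticalPretrivialization hp m ⟨y, v⟩).2 = verticalEquiv hp m hy v := rfl

theorem verticalPretrivialization_symm (m : M) {y : M} (hy : y ∈ (hp m).domChart.source)
    (w : F) :
    (verticalPretrivialization hp m).symm y w = (verticalEquiv hp m hy).symm w := by
  apply (verticalEquiv hp m hy).injective
  rw [ContinuousLinearEquiv.apply_symm_apply, ← verticalPretrivialization_apply,
    Pretrivialization.apply_mk_symm _ hy]

instance verticalPretrivialization_isLinear (m : M) :
    (verticalPretrivialization hp m).IsLinear ℝ where
  linear _ hy := (verticalEquiv hp m hy).toLinearEquiv.toLinearMap.isLinear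

/-- The coordinate change of the vertical bundle between two submersion charts. -/
def verticalCoordChange (m m' : M) (y : M) : F →L[ℝ] F :=
  (ContinuousLinearMap.snd ℝ E' F).comp (((hp m').equiv : E →L[ℝ] E' × F).comp
    ((fderiv ℝ ((hp m').domChart ∘ (hp m).domChart.symm) ((hp m).domChart y)).comp
      (((hp m).equiv.symm : E' × F →L[ℝ] E).comp (ContinuousLinearMap.inr ℝ E' F))))

theorem contMDiffOn_verticalCoordChange (m m' : M) :
    ContMDiffOn 𝓘(ℝ, E) 𝓘(ℝ, F →L[ℝ] F) ∞ (verticalCoordChange hp m m')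
      ((hp m).domChart.source ∩ (hp m').domChart.source) := by
  have h1 : ContDiffOn ℝ ∞ ((hp m').domChart ∘ (hp m).domChart.symm)
      ((hp m).domChart.target ∩ (hp m).domChart.symm ⁻¹' (hp m').domChart.source) := by
    rw [← contMDiffOn_iff_contDiffOn]
    exact (contMDiffOn_of_mem_maximalAtlas (hp m').domChart_mem_maximalAtlas).comp
      ((contMDiffOn_symm_of_mem_maximalAtlas (hp m).domChart_mem_maximalAtlas).mono
        inter_subset_left) fun _ h ↦ h.2
  have h2 := h1.fderiv_of_isOpen (m := ∞)
    ((hp m).domChart.isOpen_inter_preimage_symm (hp m').domChart.open_source) (by simp)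
  have h3 := h2.contMDiffOn.comp
    ((contMDiffOn_of_mem_maximalAtlas (hp m).domChart_mem_maximalAtlas).mono
      (inter_subset_left (t := (hp m').domChart.source))) fun y hy ↦
      ⟨(hp m).domChart.map_source hy.1, by
        simpa [(hp m).domChart.left_inv hy.1] using hy.2⟩
  have h4 : ContDiff ℝ ∞ fun D : E →L[ℝ] E ↦ (ContinuousLinearMap.snd ℝ E' F).comp
      (((hp m').equiv : E →L[ℝ] E' × F).comp (D.comp
        (((hp m).equiv.symm : E' × F →L[ℝ] E).comp (ContinuousLinearMap.inr ℝ E' F)))) := by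
    fun_prop
  exact h4.contMDiff.comp_contMDiffOn h3

theorem verticalCoordChange_apply (m m' : M) {y : M} (hy : y ∈ (hp m).domChart.source)
    (hy' : y ∈ (hp m').domChart.source) (w : F) :
    verticalCoordChange hp m m' y w =
      (verticalPretrivialization hp m' ⟨y, (verticalPretrivialization hp m).symm y w⟩).2 := by
  rw [verticalPretrivialization_symm hp m hy, verticalPretrivialization_apply hp m' hy']
  let u : TangentSpace 𝓘(ℝ, E) y := (chartDeriv hp m hy).symm (0, w)
  have hu : (mfderiv 𝓘(ℝ, E) 𝓘(ℝ, E) (hp m).domChart y u : E) = (hp m).equiv.symm (0, w) := by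
    have h0 : (hp m).equiv (mfderiv 𝓘(ℝ, E) 𝓘(ℝ, E) (hp m).domChart y u : E) = (0, w) :=
      (chartDeriv hp m hy).apply_symm_apply (0, w)
    exact ((hp m).equiv.eq_symm_apply).2 h0
  have hs : (hp m).domChart.symm ((hp m).domChart y) = y := (hp m).domChart.left_inv hy
  have h1 : MDifferentiableAt 𝓘(ℝ, E) 𝓘(ℝ, E) ((hp m').domChart ∘ (hp m).domChart.symm)
      ((hp m).domChart y) :=
    MDifferentiableAt.comp _ (mdifferentiableAt_domChart hp m' (by rwa [hs]))
      (mdifferentiableAt_domChart_symm hp m ((hp m).domChart.map_source hy))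
  have h2 := h1.hasMFDerivAt.comp y (mdifferentiableAt_domChart hp m hy).hasMFDerivAt
  have h3 : (hp m').domChart =ᶠ[𝓝 y]
      ((hp m').domChart ∘ (hp m).domChart.symm) ∘ (hp m).domChart := by
    filter_upwards [(hp m).domChart.open_source.mem_nhds hy] with z hz
    simp [(hp m).domChart.left_inv hz]
  have h4 := DFunLike.congr_fun (h2.congr_of_eventuallyEq h3).mfderiv u
  have h5 : (mfderiv 𝓘(ℝ, E) 𝓘(ℝ, E) (hp m').domChart y u : E) =
      fderiv ℝ ((hp m').domChart ∘ (hp m).domChart.symm) ((hp m).domChart y)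
        ((hp m).equiv.symm (0, w)) := by
    rw [← hu, ← mfderiv_eq_fderiv]
    exact h4
  change _ = ((hp m').equiv (mfderiv 𝓘(ℝ, E) 𝓘(ℝ, E) (hp m').domChart y u : E)).2
  rw [h5]
  rfl

/-- The vertical bundle as a vector bundle with typical fibre `F`. -/
def verticalPrebundle : VectorPrebundle ℝ F (Vertical hp) where
  pretrivializationAtlas := range (verticalPretrivialization hp)
  pretrivialization_linear' := by
    rintro _ ⟨m, rfl⟩
    infer_instance
  pretrivializationAt := verticalPretrivialization hp
  mem_base_pretrivializationAt m := (hp m).mem_domChart_source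
  pretrivialization_mem_atlas := mem_range_self
  exists_coordChange := by
    rintro _ ⟨m, rfl⟩ _ ⟨m', rfl⟩
    exact ⟨verticalCoordChange hp m m', (contMDiffOn_verticalCoordChange hp m m').continuousOn,
      fun y hy w ↦ verticalCoordChange_apply hp m m' hy.1 hy.2 w⟩
  totalSpaceMk_isInducing m :=
    (isInducing_const_prod.2 IsInducing.id).comp
      (verticalEquiv hp m (hp m).mem_domChart_source).toHomeomorph.isInducing

instance : (verticalPrebundle hp).IsContMDiff 𝓘(ℝ, E) ∞ where
  exists_contMDiffCoordChange := by
    rintro _ ⟨m, rfl⟩ _ ⟨m', rfl⟩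
    exact ⟨verticalCoordChange hp m m', contMDiffOn_verticalCoordChange hp m m',
      fun y hy w ↦ verticalCoordChange_apply hp m m' hy.1 hy.2 w⟩

instance : TopologicalSpace (TotalSpace F (Vertical hp)) :=
  (verticalPrebundle hp).totalSpaceTopology

instance : FiberBundle F (Vertical hp) := (verticalPrebundle hp).toFiberBundle

instance : VectorBundle ℝ F (Vertical hp) := (verticalPrebundle hp).toVectorBundle

instance : ContMDiffVectorBundle ∞ F (Vertical hp) 𝓘(ℝ, E) :=
  (verticalPrebundle hp).contMDiffVectorBundle 𝓘(ℝ, E)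

theorem mfderiv_fibreIncl_mem (x : N) (y : Fibre hp x) (v : TangentSpace 𝓘(ℝ, F) y) :
    mfderiv 𝓘(ℝ, F) 𝓘(ℝ, E) (fibreIncl hp x) y v ∈
      (mfderiv 𝓘(ℝ, E) 𝓘(ℝ, E') p (fibreIncl hp x y)).ker := by
  have h1 : MDifferentiableAt 𝓘(ℝ, F) 𝓘(ℝ, E) (fibreIncl hp x) y :=
    (contMDiff_fibreIncl hp x y).mdifferentiableAt (by simp)
  have h2 : MDifferentiableAt 𝓘(ℝ, E) 𝓘(ℝ, E') p (fibreIncl hp x y) :=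
    (hp.contMDiff _).mdifferentiableAt (by simp)
  have h3 := h2.hasMFDerivAt.comp y h1.hasMFDerivAt
  have h4 : p ∘ fibreIncl hp x = fun _ ↦ x := funext fun z ↦ z.2
  rw [h4] at h3
  exact DFunLike.congr_fun (hasMFDerivAt_unique h3 (hasMFDerivAt_const x y)) v

/-- The tangent map of the inclusion of a fibre, as a map into the vertical bundle. -/
def fibreTangentIncl (x : N) (v : TangentBundle 𝓘(ℝ, F) (Fibre hp x)) :
    TotalSpace F (Vertical hp) :=
  ⟨fibreIncl hp x v.1, ⟨mfderiv 𝓘(ℝ, F) 𝓘(ℝ, E) (fibreIncl hp x) v.1 v.2,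
    mfderiv_fibreIncl_mem hp x v.1 v.2⟩⟩

end

end Submersion

/-! ### Sprays on anchored bundles -/

section AnchoredBundle

variable {E F : Type*} [NormedAddCommGroup E] [NormedSpace ℝ E]
  [NormedAddCommGroup F] [NormedSpace ℝ F]
  {M : Type*} [TopologicalSpace M] [ChartedSpace E M] [IsManifold 𝓘(ℝ, E) ∞ M]
  {V : M → Type*} [TopologicalSpace (TotalSpace F V)] [∀ m, AddCommGroup (V m)]
  [∀ m, Module ℝ (V m)] [∀ m, TopologicalSpace (V m)] [FiberBundle F V] [VectorBundle ℝ F V]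
  [ContMDiffVectorBundle ∞ F V 𝓘(ℝ, E)]

/-- Fibrewise multiplication with the scalar `a` on a vector bundle. -/
def bundleScale (a : ℝ) (v : TotalSpace F V) : TotalSpace F V := ⟨v.proj, a • v.2⟩

/-- `S` is a spray on the vector bundle `V` over `M` with anchor `ρ`: a smooth vector field on the
total space of `V` with `Tπ ∘ S = ρ` and `S ∘ h_a = T h_a (a S)` for all real `a`. -/
structure IsSpray (ρ : ∀ m, V m →L[ℝ] TangentSpace 𝓘(ℝ, E) m)
    (S : ∀ v : TotalSpace F V, TangentSpace (𝓘(ℝ, E).prod 𝓘(ℝ, F)) v) : Prop where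
  contMDiff : ContMDiff (𝓘(ℝ, E).prod 𝓘(ℝ, F)) (𝓘(ℝ, E).prod 𝓘(ℝ, F)).tangent ∞
    fun v ↦ (⟨v, S v⟩ : TangentBundle (𝓘(ℝ, E).prod 𝓘(ℝ, F)) (TotalSpace F V))
  lifts_anchor : ∀ v : TotalSpace F V,
    mfderiv (𝓘(ℝ, E).prod 𝓘(ℝ, F)) 𝓘(ℝ, E) (π F V) v (S v) = ρ v.proj v.2
  homogeneous : ∀ (a : ℝ) (v : TotalSpace F V),
    S (bundleScale a v) =
      mfderiv (𝓘(ℝ, E).prod 𝓘(ℝ, F)) (𝓘(ℝ, E).prod 𝓘(ℝ, F)) (bundleScale a) v (a • S v)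

/-- `w` is the value at time `1` of the flow of the vector field `S` started at `v`: there is an
integral curve of `S`, on an open interval containing `[0, 1]`, from `v` to `w`. -/
def IsTimeOneFlow (S : ∀ v : TotalSpace F V, TangentSpace (𝓘(ℝ, E).prod 𝓘(ℝ, F)) v)
    (v w : TotalSpace F V) : Prop :=
  ∃ (γ : ℝ → TotalSpace F V) (a b : ℝ), a < 0 ∧ 1 < b ∧
    IsMIntegralCurveOn (I := 𝓘(ℝ, E).prod 𝓘(ℝ, F)) γ S (Ioo a b) ∧ γ 0 = v ∧ γ 1 = w

/-- The domain of the spray exponential map: the flow of `S` is defined up to time `1`. -/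
def expDomain (S : ∀ v : TotalSpace F V, TangentSpace (𝓘(ℝ, E).prod 𝓘(ℝ, F)) v) :
    Set (TotalSpace F V) :=
  {v | ∃ w, IsTimeOneFlow S v w}

open Classical in
/-- The spray exponential map `π ∘ Fl₁` (with an irrelevant value outside of its domain). -/
def sprayExp (S : ∀ v : TotalSpace F V, TangentSpace (𝓘(ℝ, E).prod 𝓘(ℝ, F)) v)
    (v : TotalSpace F V) : M :=
  if h : ∃ w, IsTimeOneFlow S v w then h.choose.proj else v.proj

end AnchoredBundle

/-! ### Local additions -/

section LocalAddition

variable {E E' F : Type*} [NormedAddCommGroup E] [NormedSpace ℝ E]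
  [NormedAddCommGroup E'] [NormedSpace ℝ E'] [NormedAddCommGroup F] [NormedSpace ℝ F]
  {M N : Type*} [TopologicalSpace M] [ChartedSpace E M] [TopologicalSpace N] [ChartedSpace E' N]
  {p : M → N}

/-- `(U, Ψ)` is a local addition on the submersion `p`: `U` is an open neighbourhood of the zero
section in the vertical bundle and `Ψ` is an open embedding of `U` into `M ×_p M`, that is, a
diffeomorphism onto an open subset, with `Ψ (0_m) = (m, m)` and `pr₁ ∘ Ψ = π`. -/
structure IsLocalAddition (hp : IsSubmersionOfComplement F 𝓘(ℝ, E) 𝓘(ℝ, E') ∞ p)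
    (U : TopologicalSpace.Opens (TotalSpace F (Vertical hp))) (Ψ : U → FibreProduct hp) :
    Prop where
  zero_mem : ∀ m : M, zeroSection F (Vertical hp) m ∈ U
  isOpenEmbedding : IsOpenEmbedding Ψ
  isLocalDiffeomorph :
    IsLocalDiffeomorph (𝓘(ℝ, E).prod 𝓘(ℝ, F)) 𝓘(ℝ, E × F) ∞ Ψ
  apply_zero : ∀ m : M, (Ψ ⟨zeroSection F (Vertical hp) m, zero_mem m⟩).fst = m ∧
    (Ψ ⟨zeroSection F (Vertical hp) m, zero_mem m⟩).snd = m
  fst_apply : ∀ u : U, (Ψ u).fst = (u : TotalSpace F (Vertical hp)).proj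

variable (E M) in
/-- `M` is `C^∞`-paracompact: it is paracompact and every open cover of `M` admits a subordinate
smooth partition of unity. -/
def SmoothlyParacompact : Prop :=
  ParacompactSpace M ∧ ∀ 𝒰 : Set (Set M), (∀ u ∈ 𝒰, IsOpen u) → ⋃₀ 𝒰 = univ →
    ∃ f : SmoothPartitionOfUnity 𝒰 𝓘(ℝ, E) M univ, f.IsSubordinate fun u ↦ (u : Set M)

end LocalAddition

end Spray

end

/-!
In a local trivialisation a spray is `(x, v) ↦ (ρ v, Γ(x, v))` with `Γ` homogeneous of degree two in
`v`. Taking `Γ = 0` gives local sprays, and since the spray conditions are affine over the functions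
on the base, a partition of unity glues them.

By homogeneity a spray vanishes on the zero section and its linearisation at a zero vector is the
square-zero map `(u, w) ↦ (ρ w, 0)`. The inverse function theorem, applied to the integral equation
on a Banach space of curves, shows that near a zero vector the flow exists up to time `1` and is
smooth; exponentiating the linearisation, `exp_S` has derivative `(u, w) ↦ u + ρ w` there. Hence the
derivative `(u, w) ↦ (u, u + ρ w)` of `(π, exp_S)` at a zero vector of the vertical bundle is
invertible onto the tangent space of the fibre product, and paracompactness of the base turns
injectivity near every zero vector into injectivity on a neighbourhood of the zero section.

A vertical spray exponentiates inside the fibres because `p` is constant along its integral curves.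
In submersion charts `T ι_x` is an affine embedding, and the anchor condition says that the spray is
tangent to its image, so it restricts uniquely to the tangent bundle of each fibre.
-/

noncomputable section

namespace Spray

section Superposition

variable {K : Type*} [TopologicalSpace K] {V : Type*} [NormedAddCommGroup V]
  {W : Type*} [NormedAddCommGroup W] {Ω : Set V}

open Classical in
/-- The superposition operator `γ ↦ g ∘ γ` on continuous curves, with the junk value `0` where
`g ∘ γ` is not continuous. -/
def superpose (g : V → W) (γ : C(K, V)) : C(K, W) :=
  if h : Continuous (g ∘ γ) then ⟨g ∘ γ, h⟩ else 0

/-- The continuous curves `K → V` with values in `Ω`: the natural domain of the superposition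
operator of a map that is only controlled on `Ω`. -/
def curvesIn (K : Type*) [TopologicalSpace K] (Ω : Set V) : Set C(K, V) := {γ | ∀ t, γ t ∈ Ω}

theorem superpose_apply {g : V → W} (hg : ContinuousOn g Ω) {γ : C(K, V)}
    (hγ : γ ∈ curvesIn K Ω) (t : K) : superpose g γ t = g (γ t) := by
  have h : Continuous (g ∘ γ) := hg.comp_continuous γ.continuous hγ
  simp [superpose, h]

theorem continuousOn_superpose {g : V → W} (hg : ContinuousOn g Ω) :
    ContinuousOn (superpose g : C(K, V) → C(K, W)) (curvesIn K Ω) := by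
  rw [continuousOn_iff_continuous_domRestrict] at hg ⊢
  let corestrict (γ : curvesIn K Ω) : C(K, Ω) := ⟨fun t ↦ ⟨γ.1 t, γ.2 t⟩, by fun_prop⟩
  have h_corestrict : Continuous corestrict :=
    (ContinuousMap.isInducing_postcomp ⟨_, continuous_subtype_val⟩
      IsInducing.subtypeVal).continuous_iff.2 continuous_subtype_val
  convert (ContinuousMap.continuous_postcomp ⟨Ω.domRestrict g, hg⟩).comp h_corestrict
  ext γ t
  exact superpose_apply (continuousOn_iff_continuous_domRestrict.2 hg) γ.2 t

variable [CompactSpace K]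

theorem isOpen_curvesIn (hΩ : IsOpen Ω) : IsOpen (curvesIn K Ω) := by
  simpa [MapsTo, curvesIn] using ContinuousMap.isOpen_setOfPred_mapsTo (isCompact_univ (X := K)) hΩ

theorem eventually_forall_add_mem_and_norm_sub_le (hΩ : IsOpen Ω) {g : V → W}
    (hg : ContinuousOn g Ω) {γ : C(K, V)} (hγ : γ ∈ curvesIn K Ω) {ε : ℝ} (hε : 0 < ε) :
    ∀ᶠ r in 𝓝 (0 : V), ∀ t, γ t + r ∈ Ω ∧ ‖g (γ t + r) - g (γ t)‖ ≤ ε := by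
  suffices ∀ᶠ r in 𝓝 (0 : V), ∀ t ∈ (univ : Set K), γ t + r ∈ Ω ∧ ‖g (γ t + r) - g (γ t)‖ ≤ ε by
    simpa using this
  refine isCompact_univ.eventually_forall_of_forall_eventually fun t _ ↦ ?_
  have h_gt : ContinuousAt g (γ t) := hg.continuousAt (hΩ.mem_nhds (hγ t))
  have h_add : Filter.Tendsto (fun q : V × K ↦ γ q.2 + q.1) (𝓝 (0, t)) (𝓝 (γ t)) := by
    have : Continuous fun q : V × K ↦ γ q.2 + q.1 := by fun_prop
    simpa using this.tendsto (0, t)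
  have h_snd : Filter.Tendsto (fun q : V × K ↦ γ q.2) (𝓝 (0, t)) (𝓝 (γ t)) :=
    (γ.continuous.comp continuous_snd).tendsto (0, t)
  have h_norm := ((h_gt.tendsto.comp h_add).sub (h_gt.tendsto.comp h_snd)).norm
  rw [sub_self, norm_zero] at h_norm
  filter_upwards [h_add.eventually (hΩ.mem_nhds (hγ t)), h_norm.eventually (gt_mem_nhds hε)]
    with q hq_mem hq_norm
  exact ⟨hq_mem, hq_norm.le⟩

variable [NormedSpace ℝ V] [NormedSpace ℝ W]

set_option synthInstance.maxHeartbeats 200000 in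
-- The norm on `C(K, V →L[ℝ] W)` is expensive to find.
variable (K V W) in
/-- Pointwise application of a continuous family of operators to a continuous curve; it expresses
the derivative of a superposition operator. -/
def pointwiseApply : C(K, V →L[ℝ] W) →L[ℝ] C(K, V) →L[ℝ] C(K, W) :=
  LinearMap.mkContinuous₂
    (LinearMap.mk₂ ℝ (fun (A : C(K, V →L[ℝ] W)) (η : C(K, V)) ↦
      (⟨fun t ↦ A t (η t), by fun_prop⟩ : C(K, W)))
      (fun A B η ↦ by ext; simp) (fun a A η ↦ by ext; simp)
      (fun A η ζ ↦ by ext; simp) (fun a A η ↦ by ext; simp)) 1 fun A η ↦ by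
    rw [one_mul, ContinuousMap.norm_le _ (by positivity)]
    intro t
    exact (A t).le_of_opNorm_le_of_le (A.norm_coe_le_norm t) (η.norm_coe_le_norm t)

@[simp]
theorem pointwiseApply_apply (A : C(K, V →L[ℝ] W)) (η : C(K, V)) (t : K) :
    pointwiseApply K V W A η t = A t (η t) := rfl

theorem hasFDerivAt_superpose (hΩ : IsOpen Ω) {g : V → W} (hg : ContDiffOn ℝ 1 g Ω)
    {γ : C(K, V)} (hγ : γ ∈ curvesIn K Ω) :
    HasFDerivAt (superpose g) (pointwiseApply K V W (superpose (fderiv ℝ g) γ)) γ := by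
  have hg' : ContinuousOn (fderiv ℝ g) Ω := hg.continuousOn_fderiv_of_isOpen hΩ le_rfl
  have h_deriv : ∀ v ∈ Ω, HasFDerivAt g (fderiv ℝ g v) v := fun v hv ↦
    ((hg.differentiableOn one_ne_zero).differentiableAt (hΩ.mem_nhds hv)).hasFDerivAt
  rw [hasFDerivAt_iff_isLittleO_nhds_zero, Asymptotics.isLittleO_iff]
  intro ε hε
  obtain ⟨δ, hδ, h_ball⟩ := Metric.eventually_nhds_iff_ball.1
    (eventually_forall_add_mem_and_norm_sub_le hΩ hg' hγ hε)
  have h_near : ∀ t, ∀ v ∈ Metric.ball (γ t) δ, v ∈ Ω ∧ ‖fderiv ℝ g v - fderiv ℝ g (γ t)‖ ≤ ε := by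
    intro t v hv
    simpa using h_ball (v - γ t) (by simpa [dist_eq_norm] using hv) t
  filter_upwards [Metric.ball_mem_nhds (0 : C(K, V)) hδ] with η hη
  rw [mem_ball_zero_iff] at hη
  have h_add : ∀ t, γ t + η t ∈ Metric.ball (γ t) δ := fun t ↦ by
    simpa using (η.norm_coe_le_norm t).trans_lt hη
  rw [ContinuousMap.norm_le _ (by positivity)]
  intro t
  have h_mean : ‖g (γ t + η t) - g (γ t) - fderiv ℝ g (γ t) (γ t + η t - γ t)‖ ≤
      ε * ‖γ t + η t - γ t‖ :=
    (convex_ball (γ t) δ).norm_image_sub_le_of_norm_hasFDerivWithin_le'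
      (fun v hv ↦ (h_deriv v (h_near t v hv).1).hasFDerivWithinAt)
      (fun v hv ↦ (h_near t v hv).2) (Metric.mem_ball_self hδ) (h_add t)
  rw [add_sub_cancel_left] at h_mean
  simp only [ContinuousMap.sub_apply, pointwiseApply_apply]
  rw [superpose_apply hg.continuousOn fun s ↦ (h_near s _ (h_add s)).1,
    superpose_apply hg.continuousOn hγ, superpose_apply hg' hγ]
  exact h_mean.trans (by gcongr; exact η.norm_coe_le_norm t)

end Superposition

section SmoothSuperposition

universe u

variable {K : Type*} [TopologicalSpace K] [CompactSpace K]
  {V : Type u} [NormedAddCommGroup V] [NormedSpace ℝ V] {Ω : Set V}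

theorem contDiffOn_superpose_nat (hΩ : IsOpen Ω) (n : ℕ) :
    ∀ (W : Type u) [NormedAddCommGroup W] [NormedSpace ℝ W] (g : V → W), ContDiffOn ℝ n g Ω →
      ContDiffOn ℝ n (superpose g : C(K, V) → C(K, W)) (curvesIn K Ω) := by
  induction n with
  | zero =>
    intro W _ _ g hg
    simp only [Nat.cast_zero, contDiffOn_zero] at hg ⊢
    exact continuousOn_superpose hg
  | succ n ih =>
    intro W _ _ g hg
    have h_deriv : ∀ γ ∈ curvesIn K Ω, HasFDerivAt (superpose g)
        (pointwiseApply K V W (superpose (fderiv ℝ g) γ)) γ :=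
      fun γ hγ ↦ hasFDerivAt_superpose hΩ (hg.of_le (by norm_cast; omega)) hγ
    rw [Nat.cast_succ, contDiffOn_succ_iff_fderiv_of_isOpen (isOpen_curvesIn hΩ)]
    refine ⟨fun γ hγ ↦ (h_deriv γ hγ).differentiableAt.differentiableWithinAt, by simp, ?_⟩
    have h_superpose_fderiv := ih (V →L[ℝ] W) (fderiv ℝ g) (hg.fderiv_of_isOpen hΩ (by norm_cast))
    have h_apply : ContDiff ℝ n (pointwiseApply K V W) := by fun_prop
    have h_smooth : ContDiffOn ℝ n
        (fun γ : C(K, V) ↦ pointwiseApply K V W (superpose (fderiv ℝ g) γ)) (curvesIn K Ω) :=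
      h_apply.comp_contDiffOn h_superpose_fderiv
    exact h_smooth.congr fun γ hγ ↦ (h_deriv γ hγ).fderiv

theorem contDiffOn_superpose {W : Type u} [NormedAddCommGroup W] [NormedSpace ℝ W]
    (hΩ : IsOpen Ω) {g : V → W} (hg : ContDiffOn ℝ ∞ g Ω) :
    ContDiffOn ℝ ∞ (superpose g : C(K, V) → C(K, W)) (curvesIn K Ω) :=
  contDiffOn_infty.2 fun n ↦ contDiffOn_superpose_nat hΩ n W g (contDiffOn_infty.1 hg n)

end SmoothSuperposition

theorem exists_openPartialHomeomorph_contDiffOn_symm {X Y : Type*} [NormedAddCommGroup X]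
    [NormedSpace ℝ X] [CompleteSpace X] [NormedAddCommGroup Y] [NormedSpace ℝ Y] {f : X → Y}
    {s : Set X} {a : X} (hs : IsOpen s) (ha : a ∈ s) (hf : ContDiffOn ℝ ∞ f s) {f' : X ≃L[ℝ] Y}
    (hf' : HasFDerivAt f (f' : X →L[ℝ] Y) a) :
    ∃ e : OpenPartialHomeomorph X Y, a ∈ e.source ∧ e.source ⊆ s ∧ (e : X → Y) = f ∧
      ContDiffOn ℝ ∞ e.symm e.target := by
  have hfa : ContDiffAt ℝ ∞ f a := hf.contDiffAt (hs.mem_nhds ha)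
  let e := hfa.toOpenPartialHomeomorph f hf' (by simp)
  have h_equiv : ∀ᶠ x in 𝓝 a, fderiv ℝ f x ∈ range ((↑) : (X ≃L[ℝ] Y) → X →L[ℝ] Y) := by
    have h_cont : ContinuousAt (fderiv ℝ f) a :=
      (hf.continuousOn_fderiv_of_isOpen hs (by simp)).continuousAt (hs.mem_nhds ha)
    refine h_cont.eventually ?_
    rw [hf'.fderiv]
    exact ContinuousLinearEquiv.nhds f'
  obtain ⟨O, hO, hO_open, haO⟩ := eventually_nhds_iff.1 (h_equiv.and (hs.mem_nhds ha))
  refine ⟨e.restrOpen O hO_open, ⟨hfa.mem_toOpenPartialHomeomorph_source hf' (by simp), haO⟩,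
    fun x hx ↦ (hO x hx.2).2, hfa.toOpenPartialHomeomorph_coe hf' (by simp), fun y hy ↦ ?_⟩
  obtain ⟨⟨f'', hf''⟩, hys⟩ := hO _ ((e.restrOpen O hO_open).map_target hy).2
  have hfy : ContDiffAt ℝ ∞ f ((e.restrOpen O hO_open).symm y) := hf.contDiffAt (hs.mem_nhds hys)
  have hfy' : HasFDerivAt f (f'' : X →L[ℝ] Y) ((e.restrOpen O hO_open).symm y) := by
    rw [hf'']
    exact (hfy.differentiableAt (by simp)).hasFDerivAt
  exact ((e.restrOpen O hO_open).contDiffAt_symm hy hfy' hfy).contDiffWithinAt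

section Flow

universe u

variable {V : Type u} [NormedAddCommGroup V]

/-- The compact time interval `[-1, 2]`, which has `0` and `1` in its interior. -/
abbrev TimeInterval : Type := Icc (-1 : ℝ) 2

/-- A continuous curve on `[-1, 2]`, extended to the real line by its values at the end points. -/
def extendCurve (γ : C(TimeInterval, V)) : ℝ → V := IccExtend (by norm_num) γ

theorem continuous_extendCurve (γ : C(TimeInterval, V)) : Continuous (extendCurve γ) :=
  γ.continuous.Icc_extend'

theorem extendCurve_of_mem (γ : C(TimeInterval, V)) {t : ℝ} (ht : t ∈ Icc (-1 : ℝ) 2) :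
    extendCurve γ t = γ ⟨t, ht⟩ :=
  IccExtend_of_mem _ _ ht

theorem norm_extendCurve_le (γ : C(TimeInterval, V)) (t : ℝ) : ‖extendCurve γ t‖ ≤ ‖γ‖ :=
  γ.norm_coe_le_norm _

variable [NormedSpace ℝ V]

variable (V) in
/-- Integration of curves from time `0`. -/
def primitive : C(TimeInterval, V) →L[ℝ] C(TimeInterval, V) :=
  LinearMap.mkContinuous
    { toFun := fun γ ↦ ⟨fun t ↦ ∫ s in (0 : ℝ)..t, extendCurve γ s,
        (intervalIntegral.continuous_primitive
          (fun _ _ ↦ (continuous_extendCurve γ).intervalIntegrable _ _) 0).comp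
          continuous_subtype_val⟩
      map_add' := fun γ η ↦ by
        ext t
        exact intervalIntegral.integral_add ((continuous_extendCurve γ).intervalIntegrable _ _)
          ((continuous_extendCurve η).intervalIntegrable _ _)
      map_smul' := fun a γ ↦ by
        ext t
        exact intervalIntegral.integral_smul a _ } 2 fun γ ↦ by
    rw [ContinuousMap.norm_le _ (by positivity)]
    intro t
    refine (intervalIntegral.norm_integral_le_of_norm_le_const
      fun s _ ↦ norm_extendCurve_le γ s).trans ?_
    have h : |(t : ℝ) - 0| ≤ 2 := by
      rw [sub_zero, abs_le]
      exact ⟨by linarith [t.2.1], t.2.2⟩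
    rw [mul_comm]
    gcongr

/-- `picardDefect g γ` is `γ - ∫₀ g ∘ γ`; it is the constant `z` exactly when `γ` is an integral
curve of `g` starting at `z`. -/
def picardDefect (g : V → V) (γ : C(TimeInterval, V)) : C(TimeInterval, V) :=
  γ - primitive V (superpose g γ)

theorem contDiffOn_picardDefect {Ω : Set V} (hΩ : IsOpen Ω) {g : V → V}
    (hg : ContDiffOn ℝ ∞ g Ω) : ContDiffOn ℝ ∞ (picardDefect g) (curvesIn TimeInterval Ω) :=
  contDiff_id.contDiffOn.sub ((primitive V).contDiff.comp_contDiffOn (contDiffOn_superpose hΩ hg))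

section IntegralCurve

variable {Ω : Set V} {g : V → V} {γ : C(TimeInterval, V)} {z : V}

theorem extendCurve_eq_add_integral
    (h : picardDefect g γ = ContinuousLinearMap.const ℝ TimeInterval z) {t : ℝ}
    (ht : t ∈ Icc (-1 : ℝ) 2) :
    extendCurve γ t = z + ∫ s in (0 : ℝ)..t, extendCurve (superpose g γ) s := by
  rw [extendCurve_of_mem γ ht, ← sub_eq_iff_eq_add]
  exact DFunLike.congr_fun h ⟨t, ht⟩

theorem extendCurve_zero (h : picardDefect g γ = ContinuousLinearMap.const ℝ TimeInterval z) :
    extendCurve γ 0 = z := by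
  simpa using extendCurve_eq_add_integral h (t := 0) (by norm_num)

theorem hasDerivAt_extendCurve [CompleteSpace V] (hg : ContinuousOn g Ω)
    (hγ : γ ∈ curvesIn TimeInterval Ω)
    (h : picardDefect g γ = ContinuousLinearMap.const ℝ TimeInterval z) {t : ℝ}
    (ht : t ∈ Ioo (-1 : ℝ) 2) :
    HasDerivAt (extendCurve γ) (g (extendCurve γ t)) t := by
  have ht' := Ioo_subset_Icc_self ht
  have h_deriv := (continuous_extendCurve (superpose g γ)).integral_hasStrictDerivAt
      0 t |>.hasDerivAt.const_add z
  rw [extendCurve_of_mem _ ht', superpose_apply hg hγ, ← extendCurve_of_mem γ ht'] at h_deriv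
  refine h_deriv.congr_of_eventuallyEq ?_
  filter_upwards [isOpen_Ioo.mem_nhds ht] with s hs
  exact extendCurve_eq_add_integral h (Ioo_subset_Icc_self hs)

end IntegralCurve

section Equilibrium

variable {Ω : Set V} {g : V → V} {z₀ : V} {A : V →L[ℝ] V}

theorem picardDefect_const (hg : ContinuousOn g Ω) (hz₀ : z₀ ∈ Ω) (hgz : g z₀ = 0) :
    picardDefect g (ContinuousLinearMap.const ℝ TimeInterval z₀) =
      ContinuousLinearMap.const ℝ TimeInterval z₀ := by
  have h_superpose : superpose g (ContinuousLinearMap.const ℝ TimeInterval z₀) = 0 := by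
    ext t
    exact (superpose_apply hg (fun _ ↦ hz₀) t).trans hgz
  rw [picardDefect, h_superpose, map_zero, sub_zero]

theorem primitive_compLeftContinuous [CompleteSpace V] (γ : C(TimeInterval, V)) :
    primitive V (A.compLeftContinuous ℝ TimeInterval γ) =
      A.compLeftContinuous ℝ TimeInterval (primitive V γ) := by
  ext t
  exact A.intervalIntegral_comp_comm ((continuous_extendCurve γ).intervalIntegrable _ _)

variable (A) in
/-- The Volterra operator `γ ↦ ∫₀ A γ`. -/
def volterra : C(TimeInterval, V) →L[ℝ] C(TimeInterval, V) :=
  (primitive V).comp (A.compLeftContinuous ℝ TimeInterval)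

theorem volterra_volterra [CompleteSpace V] (hAA : ∀ v, A (A v) = 0) (γ : C(TimeInterval, V)) :
    volterra A (volterra A γ) = 0 := by
  have h_comm : A.compLeftContinuous ℝ TimeInterval (volterra A γ) =
      primitive V (A.compLeftContinuous ℝ TimeInterval (A.compLeftContinuous ℝ TimeInterval γ)) :=
    (primitive_compLeftContinuous _).symm
  have h_sq : A.compLeftContinuous ℝ TimeInterval (A.compLeftContinuous ℝ TimeInterval γ) = 0 := by
    ext t
    exact hAA _
  change primitive V (A.compLeftContinuous ℝ TimeInterval (volterra A γ)) = 0
  rw [h_comm, h_sq, map_zero, map_zero]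

theorem volterra_const_one [CompleteSpace V] (v : V) :
    volterra A (ContinuousLinearMap.const ℝ TimeInterval v) ⟨1, by norm_num⟩ = A v := by
  change ∫ _ in (0 : ℝ)..1, A v = A v
  rw [intervalIntegral.integral_const, sub_zero, one_smul]

/-- The operator `γ ↦ γ - ∫₀ A γ` for `A ∘ A = 0`, with inverse `γ ↦ γ + ∫₀ A γ`: the linearisation
of `picardDefect` at an equilibrium. -/
def idSubVolterraEquiv [CompleteSpace V] (A : V →L[ℝ] V) (hAA : ∀ v, A (A v) = 0) :
    C(TimeInterval, V) ≃L[ℝ] C(TimeInterval, V) :=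
  ContinuousLinearEquiv.equivOfInverse (ContinuousLinearMap.id ℝ _ - volterra A)
    (ContinuousLinearMap.id ℝ _ + volterra A)
    (fun γ ↦ by simp [volterra_volterra hAA]) (fun γ ↦ by simp [volterra_volterra hAA])

theorem idSubVolterraEquiv_symm_apply [CompleteSpace V] (hAA : ∀ v, A (A v) = 0)
    (γ : C(TimeInterval, V)) : (idSubVolterraEquiv A hAA).symm γ = γ + volterra A γ := rfl

theorem hasFDerivAt_picardDefect_const (hΩ : IsOpen Ω) (hg : ContDiffOn ℝ ∞ g Ω) (hz₀ : z₀ ∈ Ω)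
    (hA : HasFDerivAt g A z₀) :
    HasFDerivAt (picardDefect g)
      (ContinuousLinearMap.id ℝ _ - volterra A)
      (ContinuousLinearMap.const ℝ TimeInterval z₀) := by
  have h_mem : ContinuousLinearMap.const ℝ TimeInterval z₀ ∈ curvesIn TimeInterval Ω := fun _ ↦ hz₀
  have h_superpose : HasFDerivAt (superpose g) (A.compLeftContinuous ℝ TimeInterval)
      (ContinuousLinearMap.const ℝ TimeInterval z₀) := by
    refine (hasFDerivAt_superpose hΩ (hg.of_le (by simp)) h_mem).congr_fderiv ?_
    ext η t
    rw [pointwiseApply_apply,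
      superpose_apply (hg.continuousOn_fderiv_of_isOpen hΩ (by simp)) h_mem, ← hA.fderiv]
    rfl
  exact (hasFDerivAt_id _).sub ((primitive V).hasFDerivAt.comp _ h_superpose)

/-- The flow comes from the inverse function theorem for `picardDefect g` at the constant curve. -/
theorem exists_flow_of_sq_fderiv_eq_zero [CompleteSpace V] (hΩ : IsOpen Ω)
    (hg : ContDiffOn ℝ ∞ g Ω) (hz₀ : z₀ ∈ Ω) (hgz : g z₀ = 0)
    (hA : HasFDerivAt g A z₀) (hAA : ∀ v, A (A v) = 0) :
    ∃ (O : Set V) (c : V → ℝ → V), IsOpen O ∧ z₀ ∈ O ∧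
      (∀ z ∈ O, c z 0 = z) ∧
      (∀ z ∈ O, ∀ t ∈ Ioo (-1 : ℝ) 2, c z t ∈ Ω ∧ HasDerivAt (c z) (g (c z t)) t) ∧
      ContDiffOn ℝ ∞ (fun z ↦ c z 1) O ∧
      HasFDerivAt (fun z ↦ c z 1) (ContinuousLinearMap.id ℝ V + A) z₀ := by
  let const : V →L[ℝ] C(TimeInterval, V) := ContinuousLinearMap.const ℝ TimeInterval
  let evalOne : C(TimeInterval, V) →L[ℝ] V := ContinuousMap.evalCLM ℝ ⟨1, by norm_num⟩
  have h_const_mem : const z₀ ∈ curvesIn TimeInterval Ω := fun _ ↦ hz₀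
  have h_deriv : HasFDerivAt (picardDefect g) (idSubVolterraEquiv A hAA : _ →L[ℝ] _) (const z₀) :=
    hasFDerivAt_picardDefect_const hΩ hg hz₀ hA
  have h_const : picardDefect g (const z₀) = const z₀ := picardDefect_const hg.continuousOn hz₀ hgz
  obtain ⟨e, h_source, h_sub, h_coe, h_symm⟩ := exists_openPartialHomeomorph_contDiffOn_symm
    (isOpen_curvesIn hΩ) h_const_mem (contDiffOn_picardDefect hΩ hg) h_deriv
  have h_target : const z₀ ∈ e.target := by simpa [h_coe, h_const] using e.map_source h_source
  have h_symm_const : e.symm (const z₀) = const z₀ := by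
    simpa [h_coe, h_const] using e.left_inv h_source
  have h_mem : ∀ z ∈ const ⁻¹' e.target, e.symm (const z) ∈ curvesIn TimeInterval Ω :=
    fun z hz ↦ h_sub (e.map_target hz)
  have h_solves : ∀ z ∈ const ⁻¹' e.target, picardDefect g (e.symm (const z)) = const z :=
    fun z hz ↦ h_coe ▸ e.right_inv hz
  have h_evalOne : (fun z ↦ extendCurve (e.symm (const z)) 1) =
      evalOne ∘ e.symm ∘ const := funext fun z ↦ extendCurve_of_mem _ _
  refine ⟨const ⁻¹' e.target, fun z ↦ extendCurve (e.symm (const z)),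
    e.open_target.preimage const.continuous, h_target, fun z hz ↦ extendCurve_zero (h_solves z hz),
    fun z hz t ht ↦ ⟨h_mem z hz _, hasDerivAt_extendCurve hg.continuousOn (h_mem z hz)
      (h_solves z hz) ht⟩, ?_, ?_⟩
  · rw [h_evalOne]
    exact evalOne.contDiff.comp_contDiffOn
      (h_symm.comp const.contDiff.contDiffOn fun _ hz ↦ hz)
  · have h_symm_deriv : HasFDerivAt e.symm
        ((idSubVolterraEquiv A hAA).symm : _ →L[ℝ] _) (const z₀) :=
      e.hasFDerivAt_symm h_target (by rwa [h_coe, h_symm_const])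
    rw [h_evalOne]
    refine (evalOne.hasFDerivAt.comp z₀ (h_symm_deriv.comp z₀ const.hasFDerivAt)).congr_fderiv ?_
    ext v
    change (idSubVolterraEquiv A hAA).symm (const v) _ = v + A v
    rw [idSubVolterraEquiv_symm_apply, ContinuousMap.add_apply, volterra_const_one]
    rfl

end Equilibrium

end Flow

section TangentMaps

variable {B B' B'' : Type*} [NormedAddCommGroup B] [NormedSpace ℝ B]
  [NormedAddCommGroup B'] [NormedSpace ℝ B'] [NormedAddCommGroup B''] [NormedSpace ℝ B'']
  {H H' H'' : Type*} [TopologicalSpace H] [TopologicalSpace H'] [TopologicalSpace H'']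
  {I : ModelWithCorners ℝ B H} {I' : ModelWithCorners ℝ B' H'} {J : ModelWithCorners ℝ B'' H''}
  {X Y Z : Type*} [TopologicalSpace X] [ChartedSpace H X] [TopologicalSpace Y] [ChartedSpace H' Y]
  [TopologicalSpace Z] [ChartedSpace H'' Z]

theorem tangentBundle_mk_eq {x y : X} (h : x = y) (w : B) :
    (⟨x, w⟩ : TangentBundle I X) = ⟨y, w⟩ := by
  rw [h]

theorem contMDiffOn_mfderiv_apply [IsManifold I ∞ X] [IsManifold I' ∞ Y] {f : X → Y} {s : Set X}
    (hs : IsOpen s) (hf : ContMDiffOn I I' ∞ f s) {t : Set Z} {σ : Z → X}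
    {ξ : ∀ z, TangentSpace I (σ z)}
    (hσ : ContMDiffOn J I.tangent ∞ (fun z ↦ (⟨σ z, ξ z⟩ : TangentBundle I X)) t)
    (ht : MapsTo σ t s) :
    ContMDiffOn J I'.tangent ∞
      (fun z ↦ (⟨f (σ z), mfderiv I I' f (σ z) (ξ z)⟩ : TangentBundle I' Y)) t := by
  have h_tangentMap := hf.contMDiffOn_tangentMapWithin (m := ∞) (by simp) hs.uniqueMDiffOn
  refine (h_tangentMap.comp hσ fun z hz ↦ ht hz).congr fun z hz ↦ ?_
  simp only [comp_apply, tangentMapWithin, mfderivWithin_of_isOpen hs (ht hz)]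

theorem mfderiv_symm_mfderiv_apply (Φ : PartialDiffeomorph I I' X Y ∞) {x : X}
    (hx : x ∈ Φ.source) (v : TangentSpace I x) :
    mfderiv I' I Φ.symm (Φ x) (mfderiv I I' Φ x v) = v := by
  have h_comp := (Φ.symm.mdifferentiableAt (by simp) (Φ.map_source hx)).hasMFDerivAt.comp x
    (Φ.mdifferentiableAt (by simp) hx).hasMFDerivAt
  have h_id : (Φ.symm ∘ Φ : X → X) =ᶠ[𝓝 x] id := by
    filter_upwards [Φ.open_source.mem_nhds hx] with z hz
    exact Φ.left_inv hz
  exact DFunLike.congr_fun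
    (hasMFDerivAt_unique h_comp ((hasMFDerivAt_id x).congr_of_eventuallyEq h_id)) v

theorem mfderiv_mfderiv_symm_apply (Φ : PartialDiffeomorph I I' X Y ∞) {x : X}
    (hx : x ∈ Φ.source) (w : B') :
    mfderiv I I' Φ x (mfderiv I' I Φ.symm (Φ x) w : B) = w := by
  have h : (mfderiv I I' Φ (Φ.symm (Φ x)) (mfderiv I' I Φ.symm (Φ x) w) : B') = w :=
    mfderiv_symm_mfderiv_apply Φ.symm (Φ.map_source hx) w
  rwa [show Φ.symm (Φ x) = x from Φ.left_inv hx] at h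

theorem injective_mfderiv (Φ : PartialDiffeomorph I I' X Y ∞) {x : X} (hx : x ∈ Φ.source) :
    Injective (mfderiv I I' Φ x) :=
  LeftInverse.injective (g := mfderiv I' I Φ.symm (Φ x)) (mfderiv_symm_mfderiv_apply Φ hx)

end TangentMaps

section PrincipalPart

variable {B B' : Type*} [NormedAddCommGroup B] [NormedSpace ℝ B]
  [NormedAddCommGroup B'] [NormedSpace ℝ B']
  {H : Type*} [TopologicalSpace H] {I : ModelWithCorners ℝ B H}
  {X : Type*} [TopologicalSpace X] [ChartedSpace H X]
  (Φ : PartialDiffeomorph I 𝓘(ℝ, B') X B' ∞)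

/-- The principal part of the vector field `S` in the chart `Φ`. -/
def principalPart (S : ∀ x : X, TangentSpace I x) (z : B') : B' :=
  mfderiv I 𝓘(ℝ, B') Φ (Φ.symm z) (S (Φ.symm z))

theorem principalPart_apply (S : ∀ x : X, TangentSpace I x) {x : X} (hx : x ∈ Φ.source) :
    principalPart Φ S (Φ x) = mfderiv I 𝓘(ℝ, B') Φ x (S x) := by
  rw [principalPart, show Φ.symm (Φ x) = x from Φ.left_inv hx]

variable [IsManifold I ∞ X]

theorem contDiffOn_principalPart {S : ∀ x : X, TangentSpace I x}
    (hS : ContMDiff I I.tangent ∞ fun x ↦ (⟨x, S x⟩ : TangentBundle I X)) :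
    ContDiffOn ℝ ∞ (principalPart Φ S) Φ.target := by
  rw [← contMDiffOn_iff_contDiffOn]
  have h_field := contMDiffOn_mfderiv_apply Φ.open_source Φ.contMDiffOn
    (hS.contMDiffOn.comp Φ.symm.contMDiffOn (t := univ) fun _ _ ↦ mem_univ _)
    (fun z hz ↦ Φ.map_target hz)
  exact (contMDiff_snd_tangentBundle_modelSpace B' 𝓘(ℝ, B')).comp_contMDiffOn h_field

theorem contMDiffOn_mfderiv_symm {h : X → B'} (hh : ContMDiffOn I 𝓘(ℝ, B') ∞ h Φ.source) :
    ContMDiffOn I I.tangent ∞ (fun x ↦ (⟨x, mfderiv 𝓘(ℝ, B') I Φ.symm (Φ x) (h x)⟩ :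
      TangentBundle I X)) Φ.source := by
  have h_field : ContMDiffOn I 𝓘(ℝ, B').tangent ∞
      (fun x ↦ (⟨Φ x, h x⟩ : TangentBundle 𝓘(ℝ, B') B')) Φ.source := fun x hx ↦
    contMDiffWithinAt_totalSpace.2 ⟨Φ.contMDiffOn x hx, by
      simpa only [trivializationAt_model_space_apply] using hh x hx⟩
  exact (contMDiffOn_mfderiv_apply (σ := Φ) (ξ := h) Φ.open_target Φ.symm.contMDiffOn h_field
    fun x hx ↦ Φ.map_source hx).congr fun x hx ↦ tangentBundle_mk_eq (Φ.left_inv hx).symm _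

end PrincipalPart

theorem mdifferentiable_of_mem_maximalAtlas {B H X : Type*} [NormedAddCommGroup B]
    [NormedSpace ℝ B] [TopologicalSpace H] {I : ModelWithCorners ℝ B H} [TopologicalSpace X]
    [ChartedSpace H X] [IsManifold I ∞ X] {φ : OpenPartialHomeomorph X H}
    (hφ : φ ∈ IsManifold.maximalAtlas I ∞ X) : φ.MDifferentiable I I :=
  ⟨(contMDiffOn_of_mem_maximalAtlas hφ).mdifferentiableOn (by simp),
    (contMDiffOn_symm_of_mem_maximalAtlas hφ).mdifferentiableOn (by simp)⟩

section AnchoredBundle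

variable {E F : Type*} [NormedAddCommGroup E] [NormedSpace ℝ E]
  [NormedAddCommGroup F] [NormedSpace ℝ F]
  {M : Type*} [TopologicalSpace M] [ChartedSpace E M]
  {V : M → Type*} [TopologicalSpace (TotalSpace F V)] [∀ m, AddCommGroup (V m)]
  [∀ m, Module ℝ (V m)] [∀ m, TopologicalSpace (V m)] [FiberBundle F V] [VectorBundle ℝ F V]

theorem contMDiff_bundleScale (a : ℝ) :
    ContMDiff (𝓘(ℝ, E).prod 𝓘(ℝ, F)) (𝓘(ℝ, E).prod 𝓘(ℝ, F)) ∞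
      (bundleScale a : TotalSpace F V → TotalSpace F V) := by
  intro v
  obtain ⟨h_proj, h_fibre⟩ := contMDiffAt_totalSpace.1
    (contMDiffAt_id (I := 𝓘(ℝ, E).prod 𝓘(ℝ, F)) (n := ∞) (x := v))
  refine contMDiffAt_totalSpace.2 ⟨h_proj, ?_⟩
  have h_smul : ContMDiffAt (𝓘(ℝ, E).prod 𝓘(ℝ, F)) 𝓘(ℝ, F) ∞
      (fun w : TotalSpace F V ↦ a • (trivializationAt F V v.proj w).2) v :=
    ((a • ContinuousLinearMap.id ℝ F).contMDiff (n := ∞)).contMDiffAt.comp v h_fibre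
  refine h_smul.congr_of_eventuallyEq ?_
  have h_nhds : π F V ⁻¹' (trivializationAt F V v.proj).baseSet ∈ 𝓝 v :=
    ((trivializationAt F V v.proj).open_baseSet.preimage
      (FiberBundle.continuous_proj F V)).mem_nhds (FiberBundle.mem_baseSet_trivializationAt' v.proj)
  filter_upwards [h_nhds] with w hw
  exact ((trivializationAt F V v.proj).linear ℝ hw).map_smul a w.2

theorem mdifferentiable_bundleScale (a : ℝ) :
    MDifferentiable (𝓘(ℝ, E).prod 𝓘(ℝ, F)) (𝓘(ℝ, E).prod 𝓘(ℝ, F))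
      (bundleScale a : TotalSpace F V → TotalSpace F V) :=
  (contMDiff_bundleScale a).mdifferentiable (by simp)

variable [ContMDiffVectorBundle ∞ F V 𝓘(ℝ, E)]
  {φ : OpenPartialHomeomorph M E} (hφ : φ ∈ IsManifold.maximalAtlas 𝓘(ℝ, E) ∞ M)
  (e : Trivialization F (π F V)) [MemTrivializationAtlas e]

/-- The chart of the total space of a vector bundle given by a chart `φ` of the base and a
trivialisation `e` of the bundle. -/
def bundleChart : PartialDiffeomorph (𝓘(ℝ, E).prod 𝓘(ℝ, F)) 𝓘(ℝ, E × F)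
    (TotalSpace F V) (E × F) ∞ where
  toFun v := (φ v.proj, (e v).2)
  invFun z := e.toOpenPartialHomeomorph.symm (φ.symm z.1, z.2)
  source := π F V ⁻¹' (φ.source ∩ e.baseSet)
  target := (φ.target ∩ φ.symm ⁻¹' e.baseSet) ×ˢ univ
  map_source' v hv := ⟨⟨φ.map_source hv.1, by
    simpa only [mem_preimage, φ.left_inv hv.1] using hv.2⟩, mem_univ _⟩
  map_target' z hz := by
    have h_proj : (e.toOpenPartialHomeomorph.symm (φ.symm z.1, z.2)).proj = φ.symm z.1 :=
      e.proj_symm_apply (e.mem_target.2 hz.1.2)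
    rw [mem_preimage, h_proj]
    exact ⟨φ.map_target hz.1.1, hz.1.2⟩
  left_inv' v hv := by
    rw [φ.left_inv hv.1]
    exact e.symm_apply_mk_proj (e.mem_source.2 hv.2)
  right_inv' z hz := by
    have h_target : (φ.symm z.1, z.2) ∈ e.target := e.mem_target.2 hz.1.2
    have h_proj : (e.toOpenPartialHomeomorph.symm (φ.symm z.1, z.2)).proj = φ.symm z.1 :=
      e.proj_symm_apply h_target
    rw [h_proj, φ.right_inv hz.1.1, e.apply_symm_apply h_target]
  open_source := (φ.open_source.inter e.open_baseSet).preimage (FiberBundle.continuous_proj F V)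
  open_target := (φ.isOpen_inter_preimage_symm e.open_baseSet).prod isOpen_univ
  contMDiffOn_toFun := by
    have h_base := (contMDiffOn_of_mem_maximalAtlas hφ).comp
      (contMDiff_proj V (F := F) (IB := 𝓘(ℝ, E)) (n := ∞)).contMDiffOn
      (s := π F V ⁻¹' (φ.source ∩ e.baseSet)) fun v hv ↦ hv.1
    have h_triv : ContMDiffOn (𝓘(ℝ, E).prod 𝓘(ℝ, F)) (𝓘(ℝ, E).prod 𝓘(ℝ, F)) ∞ e e.source :=
      e.contMDiffOn
    exact h_base.prodMk_space
      (contMDiff_snd.comp_contMDiffOn (h_triv.mono fun v hv ↦ e.mem_source.2 hv.2))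
  contMDiffOn_invFun := by
    have h_fst : ContMDiff 𝓘(ℝ, E × F) 𝓘(ℝ, E) ∞ (Prod.fst : E × F → E) := contDiff_fst.contMDiff
    have h_snd : ContMDiff 𝓘(ℝ, E × F) 𝓘(ℝ, F) ∞ (Prod.snd : E × F → F) := contDiff_snd.contMDiff
    have h_triv : ContMDiffOn (𝓘(ℝ, E).prod 𝓘(ℝ, F)) (𝓘(ℝ, E).prod 𝓘(ℝ, F)) ∞
        e.toOpenPartialHomeomorph.symm e.target := e.contMDiffOn_symm
    exact h_triv.comp (((contMDiffOn_symm_of_mem_maximalAtlas hφ).comp h_fst.contMDiffOn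
      fun _ hz ↦ hz.1.1).prodMk h_snd.contMDiffOn) fun z hz ↦ e.mem_target.2 hz.1.2

variable {e} {v : TotalSpace F V}

theorem bundleChart_bundleScale (a : ℝ) (hv : v ∈ (bundleChart hφ e).source) :
    bundleChart hφ e (bundleScale a v) =
      ((bundleChart hφ e v).1, a • (bundleChart hφ e v).2) :=
  Prod.ext rfl ((e.linear ℝ hv.2).map_smul a v.2)

theorem bundleChart_zeroSection {m : M} (hm : m ∈ e.baseSet) :
    bundleChart hφ e (zeroSection F V m) = (φ m, 0) :=
  Prod.ext rfl (e.linear ℝ hm).map_zero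

theorem fst_mfderiv_bundleChart (hv : v ∈ (bundleChart hφ e).source)
    (ξ : TangentSpace (𝓘(ℝ, E).prod 𝓘(ℝ, F)) v) :
    (mfderiv (𝓘(ℝ, E).prod 𝓘(ℝ, F)) 𝓘(ℝ, E × F) (bundleChart hφ e) v ξ : E × F).1 =
      mfderiv 𝓘(ℝ, E) 𝓘(ℝ, E) φ v.proj
        (mfderiv (𝓘(ℝ, E).prod 𝓘(ℝ, F)) 𝓘(ℝ, E) (π F V) v ξ) := by
  have h_fst := (ContinuousLinearMap.fst ℝ E F).hasMFDerivAt.comp v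
    ((bundleChart hφ e).mdifferentiableAt (by simp) hv).hasMFDerivAt
  have h_base := ((contMDiffAt_of_mem_maximalAtlas hφ hv.1).mdifferentiableAt
    (by simp)).hasMFDerivAt.comp v ((contMDiff_proj V (F := F) (IB := 𝓘(ℝ, E))
      (n := ∞)).mdifferentiable (by simp) v).hasMFDerivAt
  exact DFunLike.congr_fun (hasMFDerivAt_unique h_fst h_base) ξ

theorem mfderiv_bundleChart_bundleScale (a : ℝ) (hv : v ∈ (bundleChart hφ e).source)
    (ξ : TangentSpace (𝓘(ℝ, E).prod 𝓘(ℝ, F)) v) :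
    (mfderiv (𝓘(ℝ, E).prod 𝓘(ℝ, F)) 𝓘(ℝ, E × F) (bundleChart hφ e) (bundleScale a v)
      (mfderiv (𝓘(ℝ, E).prod 𝓘(ℝ, F)) (𝓘(ℝ, E).prod 𝓘(ℝ, F)) (bundleScale a) v ξ) : E × F) =
      ((mfderiv (𝓘(ℝ, E).prod 𝓘(ℝ, F)) 𝓘(ℝ, E × F) (bundleChart hφ e) v ξ : E × F).1,
        a • (mfderiv (𝓘(ℝ, E).prod 𝓘(ℝ, F)) 𝓘(ℝ, E × F) (bundleChart hφ e) v ξ : E × F).2) := by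
  have h_scale := ((bundleChart hφ e).mdifferentiableAt (by simp)
    (x := bundleScale a v) hv).hasMFDerivAt.comp v (mdifferentiable_bundleScale a v).hasMFDerivAt
  let D : E × F →L[ℝ] E × F := (ContinuousLinearMap.fst ℝ E F).prod
    (a • ContinuousLinearMap.snd ℝ E F)
  have h_D := D.hasMFDerivAt.comp v
    ((bundleChart hφ e).mdifferentiableAt (by simp) hv).hasMFDerivAt
  have h_eq : (bundleChart hφ e ∘ bundleScale a : TotalSpace F V → E × F) =ᶠ[𝓝 v]
      D ∘ bundleChart hφ e := by
    filter_upwards [(bundleChart hφ e).open_source.mem_nhds hv] with w hw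
    exact bundleChart_bundleScale hφ a hw
  exact DFunLike.congr_fun (hasMFDerivAt_unique h_scale (h_D.congr_of_eventuallyEq h_eq)) ξ

variable (ρ : ∀ m, V m →L[ℝ] TangentSpace 𝓘(ℝ, E) m)

variable (e) in
/-- The spray, over the domain of a bundle chart, whose integral curves have constant coordinate
in the fibre; it has no second-order part in the chart. -/
def flatSpray (v : TotalSpace F V) : TangentSpace (𝓘(ℝ, E).prod 𝓘(ℝ, F)) v :=
  mfderiv 𝓘(ℝ, E × F) (𝓘(ℝ, E).prod 𝓘(ℝ, F)) (bundleChart hφ e).symm (bundleChart hφ e v)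
    ((mfderiv 𝓘(ℝ, E) 𝓘(ℝ, E) φ v.proj (ρ v.proj v.2), 0) : E × F)

variable {ρ}

theorem mfderiv_bundleChart_flatSpray (hv : v ∈ (bundleChart hφ e).source) :
    (mfderiv (𝓘(ℝ, E).prod 𝓘(ℝ, F)) 𝓘(ℝ, E × F) (bundleChart hφ e) v (flatSpray hφ e ρ v) :
      E × F) = (mfderiv 𝓘(ℝ, E) 𝓘(ℝ, E) φ v.proj (ρ v.proj v.2), 0) :=
  mfderiv_mfderiv_symm_apply (bundleChart hφ e) hv _

theorem contMDiffOn_flatSpray [IsManifold 𝓘(ℝ, E) ∞ M]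
    (hρ : ContMDiff (𝓘(ℝ, E).prod 𝓘(ℝ, F)) 𝓘(ℝ, E).tangent ∞
      fun v : TotalSpace F V ↦ (⟨v.proj, ρ v.proj v.2⟩ : TangentBundle 𝓘(ℝ, E) M)) :
    ContMDiffOn (𝓘(ℝ, E).prod 𝓘(ℝ, F)) (𝓘(ℝ, E).prod 𝓘(ℝ, F)).tangent ∞
      (fun v ↦ (⟨v, flatSpray hφ e ρ v⟩ :
        TangentBundle (𝓘(ℝ, E).prod 𝓘(ℝ, F)) (TotalSpace F V)))
      (bundleChart hφ e).source := by
  have h_anchor := (contMDiff_snd_tangentBundle_modelSpace E 𝓘(ℝ, E)).comp_contMDiffOn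
    (contMDiffOn_mfderiv_apply φ.open_source (contMDiffOn_of_mem_maximalAtlas hφ)
      (hρ.contMDiffOn (s := (bundleChart hφ e).source)) fun v hv ↦ hv.1)
  exact contMDiffOn_mfderiv_symm (bundleChart hφ e) (h_anchor.prodMk_space contMDiffOn_const)

theorem mfderiv_proj_flatSpray [IsManifold 𝓘(ℝ, E) ∞ M] (hv : v ∈ (bundleChart hφ e).source) :
    mfderiv (𝓘(ℝ, E).prod 𝓘(ℝ, F)) 𝓘(ℝ, E) (π F V) v (flatSpray hφ e ρ v) = ρ v.proj v.2 := by
  have h_fst := fst_mfderiv_bundleChart hφ hv (flatSpray hφ e ρ v)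
  rw [mfderiv_bundleChart_flatSpray hφ hv] at h_fst
  exact (mdifferentiable_of_mem_maximalAtlas hφ).mfderiv_injective hv.1 h_fst.symm

theorem flatSpray_bundleScale (a : ℝ) (hv : v ∈ (bundleChart hφ e).source) :
    flatSpray hφ e ρ (bundleScale a v) =
      mfderiv (𝓘(ℝ, E).prod 𝓘(ℝ, F)) (𝓘(ℝ, E).prod 𝓘(ℝ, F)) (bundleScale a) v
        (a • flatSpray hφ e ρ v) := by
  apply injective_mfderiv (bundleChart hφ e) (x := bundleScale a v) hv
  refine (mfderiv_bundleChart_flatSpray hφ (v := bundleScale a v) hv).trans ?_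
  refine Eq.trans ?_ (mfderiv_bundleChart_bundleScale hφ a hv (a • flatSpray hφ e ρ v)).symm
  rw [map_smul, mfderiv_bundleChart_flatSpray hφ hv]
  refine Prod.ext ?_ ?_
  · change mfderiv 𝓘(ℝ, E) 𝓘(ℝ, E) φ v.proj (ρ v.proj (a • v.2)) =
      a • mfderiv 𝓘(ℝ, E) 𝓘(ℝ, E) φ v.proj (ρ v.proj v.2)
    rw [map_smul, map_smul]
  · change (0 : F) = a • a • 0
    simp only [smul_zero]

end AnchoredBundle

theorem map_finsum_smul_eq {ι W W' : Type*} [AddCommGroup W] [Module ℝ W] [AddCommGroup W']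
    [Module ℝ W'] (L : W →ₗ[ℝ] W') {c : ι → ℝ} (hc : (support c).Finite) {s : ι → W} {t : ι → W'}
    (hst : ∀ i, c i ≠ 0 → L (s i) = t i) : L (∑ᶠ i, c i • s i) = ∑ᶠ i, c i • t i := by
  rw [map_finsum L (f := fun i ↦ c i • s i) (hc.subset (support_smul_subset_left c s))]
  refine finsum_congr fun i ↦ ?_
  rw [map_smul]
  by_cases hi : c i = 0
  · rw [hi, zero_smul, zero_smul]
  · rw [hst i hi]

section SprayExistence

variable {E F : Type*} [NormedAddCommGroup E] [NormedSpace ℝ E]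
  [NormedAddCommGroup F] [NormedSpace ℝ F]
  {M : Type*} [TopologicalSpace M] [ChartedSpace E M] [IsManifold 𝓘(ℝ, E) ∞ M]
  {V : M → Type*} [TopologicalSpace (TotalSpace F V)] [∀ m, AddCommGroup (V m)]
  [∀ m, Module ℝ (V m)] [∀ m, TopologicalSpace (V m)] [FiberBundle F V] [VectorBundle ℝ F V]
  [ContMDiffVectorBundle ∞ F V 𝓘(ℝ, E)] {ρ : ∀ m, V m →L[ℝ] TangentSpace 𝓘(ℝ, E) m}

variable (ρ) in
/-- `S` restricts to a spray with anchor `ρ` over the subset `u` of the base. -/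
structure IsSprayOn (u : Set M)
    (S : ∀ v : TotalSpace F V, TangentSpace (𝓘(ℝ, E).prod 𝓘(ℝ, F)) v) : Prop where
  contMDiffOn : ContMDiffOn (𝓘(ℝ, E).prod 𝓘(ℝ, F)) (𝓘(ℝ, E).prod 𝓘(ℝ, F)).tangent ∞
    (fun v ↦ (⟨v, S v⟩ : TangentBundle (𝓘(ℝ, E).prod 𝓘(ℝ, F)) (TotalSpace F V))) (π F V ⁻¹' u)
  lifts_anchor : ∀ v : TotalSpace F V, v.proj ∈ u →
    mfderiv (𝓘(ℝ, E).prod 𝓘(ℝ, F)) 𝓘(ℝ, E) (π F V) v (S v) = ρ v.proj v.2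
  homogeneous : ∀ (a : ℝ) (v : TotalSpace F V), v.proj ∈ u →
    S (bundleScale a v) =
      mfderiv (𝓘(ℝ, E).prod 𝓘(ℝ, F)) (𝓘(ℝ, E).prod 𝓘(ℝ, F)) (bundleScale a) v (a • S v)

theorem isSprayOn_flatSpray {φ : OpenPartialHomeomorph M E}
    (hφ : φ ∈ IsManifold.maximalAtlas 𝓘(ℝ, E) ∞ M)
    (e : Trivialization F (π F V)) [MemTrivializationAtlas e]
    (hρ : ContMDiff (𝓘(ℝ, E).prod 𝓘(ℝ, F)) 𝓘(ℝ, E).tangent ∞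
      fun v : TotalSpace F V ↦ (⟨v.proj, ρ v.proj v.2⟩ : TangentBundle 𝓘(ℝ, E) M)) :
    IsSprayOn ρ (φ.source ∩ e.baseSet) (flatSpray hφ e ρ) where
  contMDiffOn := contMDiffOn_flatSpray hφ hρ
  lifts_anchor _ hv := mfderiv_proj_flatSpray hφ hv
  homogeneous a _ hv := flatSpray_bundleScale hφ a hv

section Gluing

variable {ι : Type*} {f : SmoothPartitionOfUnity ι 𝓘(ℝ, E) M univ} {u : ι → Set M}
  {S : ι → ∀ v : TotalSpace F V, TangentSpace (𝓘(ℝ, E).prod 𝓘(ℝ, F)) v}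

theorem contMDiff_finsum_smul (hu : ∀ i, IsOpen (u i)) (hfu : f.IsSubordinate u)
    (hS : ∀ i, ContMDiffOn (𝓘(ℝ, E).prod 𝓘(ℝ, F)) (𝓘(ℝ, E).prod 𝓘(ℝ, F)).tangent ∞
      (fun v ↦ (⟨v, S i v⟩ : TangentBundle (𝓘(ℝ, E).prod 𝓘(ℝ, F)) (TotalSpace F V)))
      (π F V ⁻¹' u i)) :
    ContMDiff (𝓘(ℝ, E).prod 𝓘(ℝ, F)) (𝓘(ℝ, E).prod 𝓘(ℝ, F)).tangent ∞
      fun v ↦ (⟨v, ∑ᶠ i, f i v.proj • S i v⟩ :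
        TangentBundle (𝓘(ℝ, E).prod 𝓘(ℝ, F)) (TotalSpace F V)) := by
  have h_proj : ContMDiff (𝓘(ℝ, E).prod 𝓘(ℝ, F)) 𝓘(ℝ, E) ∞ (π F V) := contMDiff_proj V
  refine ContMDiff.finsum_section_of_locallyFinite (t := fun i v ↦ f i v.proj • S i v)
    ((f.locallyFinite.preimage_continuous h_proj.continuous).subset
      fun i v hv ↦ left_ne_zero_of_smul hv) fun i ↦ ?_
  exact ContMDiffOn.smul_section_of_tsupport (ψ := fun v ↦ f i v.proj)
    ((f i).contMDiff.comp h_proj).contMDiffOn ((hu i).preimage h_proj.continuous)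
    ((tsupport_comp_subset_preimage (f i) h_proj.continuous).trans fun v hv ↦ hfu i hv) (hS i)

theorem isSpray_finsum_smul (hu : ∀ i, IsOpen (u i)) (hfu : f.IsSubordinate u)
    (hS : ∀ i, IsSprayOn ρ (u i) (S i)) : IsSpray ρ fun v ↦ ∑ᶠ i, f i v.proj • S i v := by
  have h_finite (m : M) : (support fun i ↦ f i m).Finite := f.locallyFinite.point_finite m
  have h_mem {i : ι} {m : M} (hi : f i m ≠ 0) : m ∈ u i := hfu i (subset_tsupport _ hi)
  refine ⟨contMDiff_finsum_smul hu hfu fun i ↦ (hS i).contMDiffOn, fun v ↦ ?_, fun a v ↦ ?_⟩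
  · have h_lift := map_finsum_smul_eq
      (mfderiv (𝓘(ℝ, E).prod 𝓘(ℝ, F)) 𝓘(ℝ, E) (π F V) v).toLinearMap (h_finite v.proj)
      (s := fun i ↦ S i v) fun i hi ↦ (hS i).lifts_anchor v (h_mem hi)
    refine h_lift.trans ?_
    rw [← finsum_smul, f.sum_eq_one (mem_univ _), one_smul]
  · have h_scale := map_finsum_smul_eq
      ((mfderiv (𝓘(ℝ, E).prod 𝓘(ℝ, F)) (𝓘(ℝ, E).prod 𝓘(ℝ, F)) (bundleScale a) v).toLinearMap.comp
        (LinearMap.lsmul ℝ _ a)) (h_finite v.proj)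
      (s := fun i ↦ S i v) fun i hi ↦ ((hS i).homogeneous a v (h_mem hi)).symm
    exact h_scale.symm

end Gluing

theorem exists_isSpray (hM : SmoothlyParacompact E M)
    (hρ : ContMDiff (𝓘(ℝ, E).prod 𝓘(ℝ, F)) 𝓘(ℝ, E).tangent ∞
      fun v : TotalSpace F V ↦ (⟨v.proj, ρ v.proj v.2⟩ : TangentBundle 𝓘(ℝ, E) M)) :
    ∃ S : ∀ v : TotalSpace F V, TangentSpace (𝓘(ℝ, E).prod 𝓘(ℝ, F)) v, IsSpray ρ S := by
  let A (m : M) : Set M := (chartAt E m).source ∩ (trivializationAt F V m).baseSet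
  have hA : ∀ u ∈ range A, IsOpen u := by
    rintro _ ⟨m, rfl⟩
    exact (chartAt E m).open_source.inter (trivializationAt F V m).open_baseSet
  obtain ⟨f, hf⟩ := hM.2 (range A) hA (eq_univ_of_forall fun m ↦
    ⟨A m, mem_range_self m, mem_chart_source E m, FiberBundle.mem_baseSet_trivializationAt' m⟩)
  choose c hc using fun i : range A ↦ i.2
  have h_flat (i : range A) : IsSprayOn ρ (i : Set M)
      (flatSpray (IsManifold.chart_mem_maximalAtlas (c i)) (trivializationAt F V (c i)) ρ) :=
    hc i ▸ isSprayOn_flatSpray _ _ hρ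
  exact ⟨_, isSpray_finsum_smul (u := Subtype.val) (fun i ↦ hA i i.2) hf h_flat⟩

end SprayExistence

theorem t2Space_totalSpace {B F : Type*} [TopologicalSpace B] [TopologicalSpace F] {V : B → Type*}
    [TopologicalSpace (TotalSpace F V)] [∀ b, TopologicalSpace (V b)] [FiberBundle F V]
    [T2Space B] [T2Space F] : T2Space (TotalSpace F V) := by
  refine ⟨fun v w hvw ↦ ?_⟩
  by_cases h_proj : v.proj = w.proj
  · let e := trivializationAt F V v.proj
    have hv : v ∈ e.source := FiberBundle.mem_trivializationAt_proj_source
    have hw : w ∈ e.source :=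
      e.mem_source.2 (h_proj ▸ FiberBundle.mem_baseSet_trivializationAt' v.proj)
    obtain ⟨s, t, hs, ht, hvs, hwt, hst⟩ := t2_separation (e.injOn.ne hv hw hvw)
    exact ⟨e.source ∩ e ⁻¹' s, e.source ∩ e ⁻¹' t,
      e.toOpenPartialHomeomorph.isOpen_inter_preimage hs,
      e.toOpenPartialHomeomorph.isOpen_inter_preimage ht, ⟨hv, hvs⟩, ⟨hw, hwt⟩,
      (hst.preimage e).mono inter_subset_right inter_subset_right⟩
  · have h_cont : Continuous (π F V) := FiberBundle.continuous_proj F V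
    obtain ⟨s, t, hs, ht, hvs, hwt, hst⟩ := t2_separation h_proj
    exact ⟨_, _, hs.preimage h_cont, ht.preimage h_cont, hvs, hwt, hst.preimage _⟩

section Homogeneous

variable {E F : Type*} [NormedAddCommGroup E] [NormedSpace ℝ E]
  [NormedAddCommGroup F] [NormedSpace ℝ F]

theorem fderiv_of_homogeneous {g : E × F → E × F} {x : E} (hg : DifferentiableAt ℝ g (x, 0))
    (hom : ∀ᶠ y in 𝓝 x, ∀ (a : ℝ) (w : F), g (y, a • w) = (a • (g (y, w)).1, a • a • (g (y, w)).2))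
    (u : E) (w : F) : fderiv ℝ g (x, 0) (u, w) = ((g (x, w)).1, 0) := by
  have h_horizontal : fderiv ℝ g (x, 0) (u, 0) = 0 := by
    have h_comp : HasFDerivAt (fun y ↦ g (y, 0))
        ((fderiv ℝ g (x, 0)).comp (ContinuousLinearMap.inl ℝ E F)) x :=
      HasFDerivAt.comp (f := fun y : E ↦ ((y, 0) : E × F)) x hg.hasFDerivAt
        (ContinuousLinearMap.inl ℝ E F).hasFDerivAt
    have h_zero : (fun y ↦ g (y, 0)) =ᶠ[𝓝 x] fun _ ↦ 0 := by
      filter_upwards [hom] with y hy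
      simpa only [zero_smul, Prod.mk_zero_zero] using hy 0 0
    exact DFunLike.congr_fun
      (h_comp.unique ((hasFDerivAt_const (0 : E × F) x).congr_of_eventuallyEq h_zero)) u
  have h_vertical : fderiv ℝ g (x, 0) (0, w) = ((g (x, w)).1, 0) := by
    have h_line : HasDerivAt (fun t : ℝ ↦ ((x, t • w) : E × F)) (0, w) 0 := by
      simpa only [id_eq, one_smul] using
        (hasDerivAt_const (0 : ℝ) x).prodMk ((hasDerivAt_id (0 : ℝ)).smul_const w)
    have h_comp : HasDerivAt (fun t : ℝ ↦ g (x, t • w)) (fderiv ℝ g (x, 0) (0, w)) 0 :=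
      HasFDerivAt.comp_hasDerivAt (f := fun t : ℝ ↦ ((x, t • w) : E × F)) 0
        (by simpa only [zero_smul] using hg.hasFDerivAt) h_line
    have h_id : HasDerivAt (fun t : ℝ ↦ t) 1 0 := hasDerivAt_id 0
    have h_expand : HasDerivAt (fun t : ℝ ↦ g (x, t • w)) ((g (x, w)).1, 0) 0 := by
      simp only [fun t : ℝ ↦ hom.self_of_nhds t w]
      simpa using (h_id.smul_const (g (x, w)).1).prodMk
        (h_id.smul (h_id.smul_const (g (x, w)).2))
    exact h_comp.unique h_expand
  rw [show (u, w) = (u, 0) + (0, w) by simp, map_add, h_horizontal, h_vertical, zero_add]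

end Homogeneous

section AnchoredBundle

variable {E F : Type*} [NormedAddCommGroup E] [NormedSpace ℝ E]
  [NormedAddCommGroup F] [NormedSpace ℝ F]
  {M : Type*} [TopologicalSpace M] [ChartedSpace E M] [IsManifold 𝓘(ℝ, E) ∞ M]
  {V : M → Type*} [TopologicalSpace (TotalSpace F V)] [∀ m, AddCommGroup (V m)]
  [∀ m, Module ℝ (V m)] [∀ m, TopologicalSpace (V m)] [FiberBundle F V] [VectorBundle ℝ F V]
  [ContMDiffVectorBundle ∞ F V 𝓘(ℝ, E)] {ρ : ∀ m, V m →L[ℝ] TangentSpace 𝓘(ℝ, E) m}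
  {S : ∀ v : TotalSpace F V, TangentSpace (𝓘(ℝ, E).prod 𝓘(ℝ, F)) v}

theorem IsSpray.isTimeOneFlow_zeroSection (hS : IsSpray ρ S) (m : M) :
    IsTimeOneFlow S (zeroSection F V m) (zeroSection F V m) := by
  have h_scale : bundleScale 0 (zeroSection F V m) = zeroSection F V m :=
    TotalSpace.ext rfl (heq_of_eq (zero_smul ℝ (0 : V m)))
  have h_zero : S (zeroSection F V m) = 0 := by
    have h_hom := hS.homogeneous 0 (zeroSection F V m)
    rwa [zero_smul, map_zero, h_scale] at h_hom
  refine ⟨fun _ ↦ zeroSection F V m, -1, 2, by norm_num, by norm_num, fun t _ ↦ ?_, rfl, rfl⟩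
  refine ((hasMFDerivAt_const (zeroSection F V m) t).congr_mfderiv ?_).hasMFDerivWithinAt
  beta_reduce
  rw [h_zero]
  exact (ContinuousLinearMap.smulRight_zero _).symm

theorem IsSpray.isTimeOneFlow_unique [CompleteSpace E] [CompleteSpace F] [T2Space M]
    (hS : IsSpray ρ S) {v w w' : TotalSpace F V} (h : IsTimeOneFlow S v w)
    (h' : IsTimeOneFlow S v w') : w = w' := by
  have : T2Space (TotalSpace F V) := t2Space_totalSpace
  obtain ⟨γ, a, b, ha, hb, hγ, hγ_zero, rfl⟩ := h
  obtain ⟨γ', a', b', ha', hb', hγ', hγ'_zero, rfl⟩ := h'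
  have h_one : (1 : ℝ) ∈ Ioo (max a a') (min b b') :=
    ⟨(max_lt ha ha').trans one_pos, lt_min hb hb'⟩
  exact isMIntegralCurveOn_Ioo_eqOn_of_contMDiff_boundaryless (t₀ := 0)
    ⟨max_lt ha ha', one_pos.trans h_one.2⟩ (hS.contMDiff.of_le (by simp))
    (hγ.mono (Ioo_subset_Ioo (le_max_left _ _) (min_le_left _ _)))
    (hγ'.mono (Ioo_subset_Ioo (le_max_right _ _) (min_le_right _ _)))
    (hγ_zero.trans hγ'_zero.symm) h_one

theorem IsSpray.sprayExp_eq [CompleteSpace E] [CompleteSpace F] [T2Space M] (hS : IsSpray ρ S)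
    {v w : TotalSpace F V} (h : IsTimeOneFlow S v w) : sprayExp S v = w.proj := by
  have h_exists : ∃ w, IsTimeOneFlow S v w := ⟨w, h⟩
  rw [sprayExp, dif_pos h_exists, hS.isTimeOneFlow_unique h_exists.choose_spec h]

theorem IsSpray.sprayExp_zeroSection [CompleteSpace E] [CompleteSpace F] [T2Space M]
    (hS : IsSpray ρ S) (m : M) : sprayExp S (zeroSection F V m) = m :=
  hS.sprayExp_eq (hS.isTimeOneFlow_zeroSection m)

theorem hasMFDerivAt_symm_of_hasDerivAt_principalPart {B B' H X : Type*} [NormedAddCommGroup B]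
    [NormedSpace ℝ B] [NormedAddCommGroup B'] [NormedSpace ℝ B'] [TopologicalSpace H]
    {I : ModelWithCorners ℝ B H} [TopologicalSpace X] [ChartedSpace H X]
    (Φ : PartialDiffeomorph I 𝓘(ℝ, B') X B' ∞) {S : ∀ x : X, TangentSpace I x}
    {c : ℝ → B'} {t : ℝ} (ht : c t ∈ Φ.target)
    (hc : HasDerivAt c (principalPart Φ S (c t)) t) :
    HasMFDerivAt 𝓘(ℝ, ℝ) I (Φ.symm ∘ c) t
      ((1 : ℝ →L[ℝ] ℝ).smulRight (S (Φ.symm (c t)))) := by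
  refine ((Φ.symm.mdifferentiableAt (by simp) ht).hasMFDerivAt.comp t
    hc.hasFDerivAt.hasMFDerivAt).congr_mfderiv ?_
  have h_chart : mfderiv 𝓘(ℝ, B') I Φ.symm (c t) (principalPart Φ S (c t) : B') =
      S (Φ.symm (c t)) :=
    mfderiv_mfderiv_symm_apply Φ.symm (x := c t) ht (S (Φ.symm (c t)))
  ext
  change mfderiv 𝓘(ℝ, B') I Φ.symm (c t) ((1 : ℝ) • principalPart Φ S (c t)) =
    (1 : ℝ) • S (Φ.symm (c t))
  rw [one_smul, one_smul, h_chart]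

section BundleChart

variable {φ : OpenPartialHomeomorph M E} {hφ : φ ∈ IsManifold.maximalAtlas 𝓘(ℝ, E) ∞ M}
  {e : Trivialization F (π F V)} [MemTrivializationAtlas e]

theorem IsSpray.fst_principalPart (hS : IsSpray ρ S) {v : TotalSpace F V}
    (hv : v ∈ (bundleChart hφ e).source) :
    (principalPart (bundleChart hφ e) S (bundleChart hφ e v)).1 =
      mfderiv 𝓘(ℝ, E) 𝓘(ℝ, E) φ v.proj (ρ v.proj v.2) := by
  rw [principalPart_apply _ S hv, ← hS.lifts_anchor]
  exact fst_mfderiv_bundleChart hφ hv (S v)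

theorem IsSpray.principalPart_smul (hS : IsSpray ρ S) (a : ℝ) {z : E × F}
    (hz : z ∈ (bundleChart hφ e).target) :
    principalPart (bundleChart hφ e) S (z.1, a • z.2) =
      (a • (principalPart (bundleChart hφ e) S z).1,
        a • a • (principalPart (bundleChart hφ e) S z).2) := by
  obtain ⟨v, hv, rfl⟩ : ∃ v ∈ (bundleChart hφ e).source, bundleChart hφ e v = z :=
    ⟨_, (bundleChart hφ e).map_target hz, (bundleChart hφ e).right_inv hz⟩
  have h_scale := mfderiv_bundleChart_bundleScale hφ a hv (a • S v)
  rw [← hS.homogeneous, map_smul, ← principalPart_apply _ S hv] at h_scale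
  rw [← bundleChart_bundleScale hφ a hv,
    principalPart_apply (bundleChart hφ e) S (x := bundleScale a v) hv]
  exact h_scale

theorem IsSpray.principalPart_eq_zero (hS : IsSpray ρ S) {x : E}
    (hx : (x, 0) ∈ (bundleChart hφ e).target) :
    principalPart (bundleChart hφ e) S (x, 0) = 0 := by
  simpa only [zero_smul, Prod.mk_zero_zero] using hS.principalPart_smul 0 hx

theorem IsSpray.fderiv_principalPart (hS : IsSpray ρ S) {x : E}
    (hx : (x, 0) ∈ (bundleChart hφ e).target) (u : E) (w : F) :
    fderiv ℝ (principalPart (bundleChart hφ e) S) (x, 0) (u, w) =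
      ((principalPart (bundleChart hφ e) S (x, w)).1, 0) := by
  refine fderiv_of_homogeneous (((contDiffOn_principalPart _ hS.contMDiff).contDiffAt
    ((bundleChart hφ e).open_target.mem_nhds hx)).differentiableAt (by simp)) ?_ u w
  filter_upwards [(φ.isOpen_inter_preimage_symm e.open_baseSet).mem_nhds hx.1] with y hy a w
  exact hS.principalPart_smul a (z := (y, w)) ⟨hy, mem_univ w⟩

theorem IsSpray.exists_flow [CompleteSpace E] [CompleteSpace F] (hS : IsSpray ρ S) {x : E}
    (hx : (x, 0) ∈ (bundleChart hφ e).target) :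
    ∃ (O : Set (E × F)) (c : E × F → E × F), IsOpen O ∧ (x, 0) ∈ O ∧
      O ⊆ (bundleChart hφ e).target ∧ (∀ z ∈ O, c z ∈ (bundleChart hφ e).target ∧
        IsTimeOneFlow S ((bundleChart hφ e).symm z) ((bundleChart hφ e).symm (c z))) ∧
      ContDiffOn ℝ ∞ c O ∧
      HasFDerivAt c (ContinuousLinearMap.id ℝ (E × F) +
        fderiv ℝ (principalPart (bundleChart hφ e) S) (x, 0)) (x, 0) := by
  have h_zero := hS.principalPart_eq_zero hx
  have h_smooth := contDiffOn_principalPart (bundleChart hφ e) hS.contMDiff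
  have h_deriv := ((h_smooth.contDiffAt
    ((bundleChart hφ e).open_target.mem_nhds hx)).differentiableAt (by simp)).hasFDerivAt
  obtain ⟨O, c, hO, hxO, hc_zero, hc, hc_smooth, hc_deriv⟩ := exists_flow_of_sq_fderiv_eq_zero
    (bundleChart hφ e).open_target h_smooth hx h_zero h_deriv fun v ↦ by
      rw [hS.fderiv_principalPart hx v.1 v.2, hS.fderiv_principalPart hx, h_zero]
      rfl
  refine ⟨O, fun z ↦ c z 1, hO, hxO, fun z hz ↦ hc_zero z hz ▸ (hc z hz 0 (by norm_num)).1,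
    fun z hz ↦ ⟨(hc z hz 1 (by norm_num)).1, ?_⟩, hc_smooth, hc_deriv⟩
  refine ⟨(bundleChart hφ e).symm ∘ c z, -1, 2, by norm_num, by norm_num, fun t ht ↦ ?_,
    congrArg (bundleChart hφ e).symm (hc_zero z hz), rfl⟩
  exact (hasMFDerivAt_symm_of_hasDerivAt_principalPart _ (hc z hz t ht).1
    (hc z hz t ht).2).hasMFDerivWithinAt

theorem IsSpray.exists_contDiffOn_sprayExp [CompleteSpace E] [CompleteSpace F] [T2Space M]
    (hS : IsSpray ρ S) {m : M} (hm : m ∈ φ.source ∩ e.baseSet) :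
    ∃ (O : Set (E × F)) (D : E × F →L[ℝ] E), IsOpen O ∧ (φ m, 0) ∈ O ∧
      O ⊆ (bundleChart hφ e).target ∧ (∀ z ∈ O, (bundleChart hφ e).symm z ∈ expDomain S ∧
        sprayExp S ((bundleChart hφ e).symm z) ∈ φ.source) ∧
      ContDiffOn ℝ ∞ (φ ∘ sprayExp S ∘ (bundleChart hφ e).symm) O ∧
      HasFDerivAt (φ ∘ sprayExp S ∘ (bundleChart hφ e).symm) D (φ m, 0) ∧
      (∀ u : E, D (u, 0) = u) ∧
      ∀ v : V m, D (0, (e ⟨m, v⟩).2) = mfderiv 𝓘(ℝ, E) 𝓘(ℝ, E) φ m (ρ m v) := by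
  have hm_target : (φ m, 0) ∈ (bundleChart hφ e).target :=
    bundleChart_zeroSection hφ hm.2 ▸
      (bundleChart hφ e).map_source (x := zeroSection F V m) hm
  obtain ⟨O, c, hO, hmO, hO_target, hc, hc_smooth, hc_deriv⟩ := hS.exists_flow hm_target
  have h_exp : ∀ z ∈ O, sprayExp S ((bundleChart hφ e).symm z) = φ.symm (c z).1 := fun z hz ↦
    (hS.sprayExp_eq (hc z hz).2).trans (e.proj_symm_apply (e.mem_target.2 (hc z hz).1.1.2))
  have h_eq : EqOn (φ ∘ sprayExp S ∘ (bundleChart hφ e).symm) (fun z ↦ (c z).1) O := fun z hz ↦ by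
    rw [comp_apply, comp_apply, h_exp z hz, φ.right_inv (hc z hz).1.1.1]
  refine ⟨O, _, hO, hmO, hO_target, fun z hz ↦ ⟨⟨_, (hc z hz).2⟩, ?_⟩, hc_smooth.fst.congr h_eq,
    hc_deriv.fst.congr_of_eventuallyEq (h_eq.eventuallyEq_of_mem (hO.mem_nhds hmO)),
    fun u ↦ ?_, fun v ↦ ?_⟩
  · rw [h_exp z hz]
    exact φ.map_target (hc z hz).1.1.1
  · change u + (fderiv ℝ (principalPart (bundleChart hφ e) S) (φ m, 0) (u, 0)).1 = u
    rw [hS.fderiv_principalPart hm_target, hS.principalPart_eq_zero hm_target]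
    exact add_zero u
  · change 0 + (fderiv ℝ (principalPart (bundleChart hφ e) S) (φ m, 0) (0, (e ⟨m, v⟩).2)).1 = _
    rw [hS.fderiv_principalPart hm_target, zero_add]
    exact hS.fst_principalPart (v := ⟨m, v⟩) hm

end BundleChart

end AnchoredBundle

section ConstantMaps

variable {B B' : Type*} [NormedAddCommGroup B] [NormedSpace ℝ B]
  [NormedAddCommGroup B'] [NormedSpace ℝ B'] {H : Type*} [TopologicalSpace H]
  {I : ModelWithCorners ℝ B' H} {Y : Type*} [TopologicalSpace Y] [ChartedSpace H Y]
  [IsManifold I 1 Y] {f : B → Y} {s : Set B}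

theorem eventually_eq_of_hasMFDerivAt_zero (hs : IsOpen s)
    (hf : ∀ z ∈ s, HasMFDerivAt 𝓘(ℝ, B) I f z 0) {x : B} (hx : x ∈ s) :
    ∀ᶠ z in 𝓝 x, f z = f x := by
  have h_cont : ContinuousOn f s := fun z hz ↦ (hf z hz).continuousAt.continuousWithinAt
  let t : Set B := s ∩ f ⁻¹' (chartAt H (f x)).source
  have ht : IsOpen t := h_cont.isOpen_inter_preimage hs (chartAt H (f x)).open_source
  have h_deriv : ∀ z ∈ t, HasFDerivAt (extChartAt I (f x) ∘ f) (0 : B →L[ℝ] B') z := fun z hz ↦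
    (((mdifferentiableAt_extChartAt hz.2).hasMFDerivAt.comp z (hf z hz.1)).congr_mfderiv
      (ContinuousLinearMap.comp_zero _)).hasFDerivAt
  have h_open : IsOpen (t ∩ extChartAt I (f x) ∘ f ⁻¹' {extChartAt I (f x) (f x)}) :=
    ht.isOpen_inter_preimage_of_fderiv_eq_zero
      (fun z hz ↦ (h_deriv z hz).differentiableAt.differentiableWithinAt)
      (fun z hz ↦ (h_deriv z hz).fderiv) _
  filter_upwards [h_open.mem_nhds ⟨⟨hx, mem_chart_source H (f x)⟩, rfl⟩] with z hz
  exact (extChartAt I (f x)).injOn (by rw [extChartAt_source]; exact hz.1.2)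
    (mem_extChartAt_source _) hz.2

theorem eq_of_hasMFDerivAt_zero (hs : IsOpen s) (hs' : IsPreconnected s)
    (hf : ∀ z ∈ s, HasMFDerivAt 𝓘(ℝ, B) I f z 0) {x y : B} (hx : x ∈ s) (hy : y ∈ s) :
    f x = f y :=
  hs'.induction₂ (fun z w ↦ f z = f w)
    (fun _ hz ↦ ((eventually_eq_of_hasMFDerivAt_zero hs hf hz).mono
      fun _ h ↦ h.symm).filter_mono nhdsWithin_le_nhds)
    (fun _ _ _ _ _ _ ↦ Eq.trans) (fun _ _ _ _ ↦ Eq.symm) hx hy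

end ConstantMaps

section AnchoredBundle

variable {E E' F : Type*} [NormedAddCommGroup E] [NormedSpace ℝ E]
  [NormedAddCommGroup E'] [NormedSpace ℝ E'] [NormedAddCommGroup F] [NormedSpace ℝ F]
  {M N : Type*} [TopologicalSpace M] [ChartedSpace E M] [IsManifold 𝓘(ℝ, E) ∞ M]
  [TopologicalSpace N] [ChartedSpace E' N] [IsManifold 𝓘(ℝ, E') 1 N]
  {V : M → Type*} [TopologicalSpace (TotalSpace F V)] [∀ m, AddCommGroup (V m)]
  [∀ m, Module ℝ (V m)] [∀ m, TopologicalSpace (V m)] [FiberBundle F V] [VectorBundle ℝ F V]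
  [ContMDiffVectorBundle ∞ F V 𝓘(ℝ, E)] {ρ : ∀ m, V m →L[ℝ] TangentSpace 𝓘(ℝ, E) m}
  {S : ∀ v : TotalSpace F V, TangentSpace (𝓘(ℝ, E).prod 𝓘(ℝ, F)) v}

theorem IsSpray.apply_proj_of_isTimeOneFlow (hS : IsSpray ρ S) {f : M → N}
    (hf : MDifferentiable 𝓘(ℝ, E) 𝓘(ℝ, E') f)
    (hfρ : ∀ m (v : V m), mfderiv 𝓘(ℝ, E) 𝓘(ℝ, E') f m (ρ m v) = 0) {v w : TotalSpace F V}
    (h : IsTimeOneFlow S v w) : f w.proj = f v.proj := by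
  obtain ⟨γ, a, b, ha, hb, hγ, rfl, rfl⟩ := h
  refine eq_of_hasMFDerivAt_zero (I := 𝓘(ℝ, E')) (f := fun t ↦ f (γ t).proj) isOpen_Ioo
    isPreconnected_Ioo (fun t ht ↦ ?_) ⟨by linarith, hb⟩ ⟨ha, by linarith⟩
  have h_proj : MDifferentiable (𝓘(ℝ, E).prod 𝓘(ℝ, F)) 𝓘(ℝ, E) (π F V) :=
    (contMDiff_proj V (n := ∞)).mdifferentiable (by simp)
  refine ((hf _).hasMFDerivAt.comp t ((h_proj (γ t)).hasMFDerivAt.comp t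
    ((hγ t ht).hasMFDerivAt (isOpen_Ioo.mem_nhds ht)))).congr_mfderiv ?_
  ext
  change mfderiv 𝓘(ℝ, E) 𝓘(ℝ, E') f (γ t).proj
    (mfderiv (𝓘(ℝ, E).prod 𝓘(ℝ, F)) 𝓘(ℝ, E) (π F V) (γ t) ((1 : ℝ) • S (γ t))) = 0
  rw [one_smul, hS.lifts_anchor, hfρ]

theorem IsSpray.apply_sprayExp (hS : IsSpray ρ S) {f : M → N}
    (hf : MDifferentiable 𝓘(ℝ, E) 𝓘(ℝ, E') f)
    (hfρ : ∀ m (v : V m), mfderiv 𝓘(ℝ, E) 𝓘(ℝ, E') f m (ρ m v) = 0) (v : TotalSpace F V) :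
    f (sprayExp S v) = f v.proj := by
  rw [sprayExp]
  split_ifs with h
  · exact hS.apply_proj_of_isTimeOneFlow hf hfρ h.choose_spec
  · rfl

end AnchoredBundle

section LocalDiffeomorphisms

variable {B B' : Type*} [NormedAddCommGroup B] [NormedSpace ℝ B]
  [NormedAddCommGroup B'] [NormedSpace ℝ B'] {H H' : Type*} [TopologicalSpace H]
  [TopologicalSpace H'] {I : ModelWithCorners ℝ B H} {I' : ModelWithCorners ℝ B' H'}
  {X Y : Type*} [TopologicalSpace X] [ChartedSpace H X] [TopologicalSpace Y] [ChartedSpace H' Y]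

/-- A chart in the maximal atlas of a manifold modelled on `B`, as a partial diffeomorphism. -/
def chartDiffeomorph {Z : Type*} [TopologicalSpace Z] [ChartedSpace B Z]
    {φ : OpenPartialHomeomorph Z B} (hφ : φ ∈ IsManifold.maximalAtlas 𝓘(ℝ, B) ∞ Z) :
    PartialDiffeomorph 𝓘(ℝ, B) 𝓘(ℝ, B) Z B ∞ where
  toPartialEquiv := φ.toPartialEquiv
  open_source := φ.open_source
  open_target := φ.open_target
  contMDiffOn_toFun := contMDiffOn_of_mem_maximalAtlas hφ
  contMDiffOn_invFun := contMDiffOn_symm_of_mem_maximalAtlas hφ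

theorem isLocalDiffeomorph_subtypeVal (U : TopologicalSpace.Opens X) :
    IsLocalDiffeomorph I I ∞ (Subtype.val : U → X) := by
  intro x
  let e := U.openPartialHomeomorphSubtypeCoe ⟨x⟩
  have h_symm : ContMDiffOn I I ∞ e.symm e.target := fun y hy ↦
    (ContMDiffWithinAt.subtypeVal_comp_iff U e.symm e.target y).1
      (contMDiffWithinAt_id.congr (fun z hz ↦ e.right_inv hz) (e.right_inv hy))
  exact ⟨⟨e.toPartialEquiv, e.open_source, e.open_target, contMDiff_subtype_val.contMDiffOn,
    h_symm⟩, mem_univ x, fun _ _ ↦ rfl⟩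

theorem exists_partialDiffeomorph_of_hasFDerivAt [CompleteSpace B]
    (Φ : PartialDiffeomorph I 𝓘(ℝ, B) X B ∞) (χ : PartialDiffeomorph I' 𝓘(ℝ, B') Y B' ∞)
    {f : X → Y} {O : Set B} (hO : IsOpen O) {x : X} (hx : x ∈ Φ.source) (hxO : Φ x ∈ O)
    (hf_maps : ∀ z ∈ O, f (Φ.symm z) ∈ χ.source) (hf : ContDiffOn ℝ ∞ (χ ∘ f ∘ Φ.symm) O)
    {f' : B ≃L[ℝ] B'} (hf' : HasFDerivAt (χ ∘ f ∘ Φ.symm) (f' : B →L[ℝ] B') (Φ x)) :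
    ∃ Θ : PartialDiffeomorph I I' X Y ∞,
      x ∈ Θ.source ∧ Θ.source ⊆ Φ.source ∩ Φ ⁻¹' O ∧ EqOn f Θ Θ.source := by
  obtain ⟨e, hxe, heO, hef, he_symm⟩ := exists_openPartialHomeomorph_contDiffOn_symm hO hxO hf hf'
  let e' : PartialDiffeomorph 𝓘(ℝ, B) 𝓘(ℝ, B') B B' ∞ :=
    ⟨e.toPartialEquiv, e.open_source, e.open_target,
      (show ContDiffOn ℝ ∞ e e.source from hef ▸ hf.mono heO).contMDiffOn, he_symm.contMDiffOn⟩
  have he'_apply : ∀ y ∈ Φ.source, e' (Φ y) = χ (f y) := fun y hy ↦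
    (congrFun hef (Φ y)).trans (congrArg (χ ∘ f) (Φ.left_inv hy))
  have hf_source : ∀ y ∈ Φ.source, Φ y ∈ O → f y ∈ χ.source := fun y hy hyO ↦ by
    simpa only [show Φ.symm (Φ y) = y from Φ.left_inv hy] using hf_maps (Φ y) hyO
  refine ⟨(Φ.trans e').trans χ.symm, ⟨⟨hx, hxe⟩, ?_⟩, fun y hy ↦ ⟨hy.1.1, heO hy.1.2⟩,
    fun y hy ↦ ?_⟩
  · change e' (Φ x) ∈ χ.target
    rw [he'_apply x hx]
    exact χ.map_source (hf_source x hx hxO)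
  · change f y = χ.symm (e' (Φ y))
    rw [he'_apply y hy.1.1]
    exact (χ.left_inv (hf_source y hy.1.1 (heO hy.1.2))).symm

end LocalDiffeomorphisms

theorem exists_isOpen_injOn {M X Y : Type*} [TopologicalSpace M] [T2Space M] [ParacompactSpace M]
    [TopologicalSpace X] {q : X → M} {s : M → X} {f : X → Y} {W : M → Set X} (hq : Continuous q)
    (hs : Continuous s) (hqs : ∀ m, q (s m) = m) (hW : ∀ m, IsOpen (W m)) (hsW : ∀ m, s m ∈ W m)
    (hfW : ∀ m, InjOn f (W m)) (hfq : ∀ x y, f x = f y → q x = q y) :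
    ∃ U : Set X, IsOpen U ∧ (∀ m, s m ∈ U) ∧ InjOn f U ∧ ∀ x ∈ U, ∃ m, x ∈ W m := by
  obtain ⟨u, hu_open, hu_cover, hu_fin, hu_sub⟩ := precise_refinement (fun m ↦ s ⁻¹' W m)
    (fun m ↦ (hW m).preimage hs) (iUnion_eq_univ_iff.2 fun m ↦ ⟨m, hsW m⟩)
  obtain ⟨C, hC_cover, hC_closed, hC_sub⟩ :=
    exists_iUnion_eq_closed_subset hu_open hu_fin.point_finite hu_cover
  have h_closed : IsClosed (⋃ m, q ⁻¹' C m ∩ (W m)ᶜ) :=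
    (((hu_fin.subset hC_sub).preimage_continuous hq).subset
      fun m ↦ inter_subset_left).isClosed_iUnion
      fun m ↦ ((hC_closed m).preimage hq).inter (hW m).isClosed_compl
  have h_mem : ∀ x ∈ (⋃ m, q ⁻¹' C m ∩ (W m)ᶜ)ᶜ, ∀ m, q x ∈ C m → x ∈ W m :=
    fun x hx m hm ↦ by_contra fun hxm ↦ hx (mem_iUnion.2 ⟨m, hm, hxm⟩)
  refine ⟨_, h_closed.isOpen_compl, fun m hm ↦ ?_, fun x hx y hy hxy ↦ ?_, fun x hx ↦ ?_⟩
  · obtain ⟨i, hi, hmi⟩ := mem_iUnion.1 hm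
    exact hmi (hu_sub i (hC_sub i (hqs m ▸ hi)))
  · obtain ⟨i, hi⟩ := iUnion_eq_univ_iff.1 hC_cover (q x)
    exact hfW i (h_mem x hx i hi) (h_mem y hy i (hfq x y hxy ▸ hi)) hxy
  · obtain ⟨i, hi⟩ := iUnion_eq_univ_iff.1 hC_cover (q x)
    exact ⟨i, h_mem x hx i hi⟩

section Submersion

variable {E E' F : Type*} [NormedAddCommGroup E] [NormedSpace ℝ E]
  [NormedAddCommGroup E'] [NormedSpace ℝ E'] [NormedAddCommGroup F] [NormedSpace ℝ F]
  {M N : Type*} [TopologicalSpace M] [ChartedSpace E M] [TopologicalSpace N] [ChartedSpace E' N]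
  {p : M → N} (hp : IsSubmersionOfComplement F 𝓘(ℝ, E) 𝓘(ℝ, E') ∞ p)

theorem completeSpace_complement [CompleteSpace E]
    (hp : IsSubmersionOfComplement F 𝓘(ℝ, E) 𝓘(ℝ, E') ∞ p) (m : M) : CompleteSpace F :=
  have : CompleteSpace (E' × F) :=
    (completeSpace_congr (e := (hp m).equiv.toEquiv) (hp m).equiv.isUniformEmbedding).1 ‹_›
  (completeSpace_prod_of_nonempty.1 this).2

/-- The chart of the vertical bundle induced by the submersion chart around `m`. -/
abbrev verticalChart (m : M) : PartialDiffeomorph (𝓘(ℝ, E).prod 𝓘(ℝ, F)) 𝓘(ℝ, E × F)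
    (TotalSpace F (Vertical hp)) (E × F) ∞ :=
  bundleChart (hp m).domChart_mem_maximalAtlas (trivializationAt F (Vertical hp) m)

variable {hp}

theorem mfderiv_domChart_verticalIncl (m : M) {v : TotalSpace F (Vertical hp)}
    (hv : v.proj ∈ (hp m).domChart.source) :
    mfderiv 𝓘(ℝ, E) 𝓘(ℝ, E) (hp m).domChart v.proj (verticalIncl hp v.proj v.2) =
      (hp m).equiv.symm (0, (verticalChart hp m v).2) :=
  ((hp m).equiv.eq_symm_apply).2 (Prod.ext ((mem_vertical_iff hp m hv _).1 v.2.2) rfl)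

variable [IsManifold 𝓘(ℝ, E) ∞ M]

variable (hp) in
theorem contMDiff_verticalIncl :
    ContMDiff (𝓘(ℝ, E).prod 𝓘(ℝ, F)) 𝓘(ℝ, E).tangent ∞
      fun v : TotalSpace F (Vertical hp) ↦
        (⟨v.proj, verticalIncl hp v.proj v.2⟩ : TangentBundle 𝓘(ℝ, E) M) := by
  intro v₀
  let Φ := verticalChart hp v₀.proj
  have hv₀ : v₀ ∈ Φ.source :=
    ⟨(hp v₀.proj).mem_domChart_source, (hp v₀.proj).mem_domChart_source⟩
  let h : E × F → E × F := fun z ↦ ((hp v₀.proj).equiv.symm (0, z.2), 0)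
  have hh : ContDiff ℝ ∞ h := by fun_prop
  have h_lift := contMDiffOn_mfderiv_symm Φ (hh.contMDiff.comp_contMDiffOn Φ.contMDiffOn)
  have h_proj := contMDiffOn_mfderiv_apply isOpen_univ
    (contMDiff_proj (Vertical hp) (F := F) (IB := 𝓘(ℝ, E)) (n := ∞)).contMDiffOn h_lift
    (mapsTo_univ _ _)
  refine (h_proj.congr fun v hv ↦ ?_).contMDiffAt (Φ.open_source.mem_nhds hv₀)
  refine congrArg (TotalSpace.mk v.proj) ?_
  apply (mdifferentiable_domChart hp v₀.proj).mfderiv_injective hv.1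
  refine (mfderiv_domChart_verticalIncl v₀.proj hv.1).trans ?_
  exact (congrArg Prod.fst (mfderiv_mfderiv_symm_apply Φ hv (h (Φ v)))).symm.trans
    (fst_mfderiv_bundleChart _ hv _)

variable [IsManifold 𝓘(ℝ, E') ∞ N]
  {S : ∀ v : TotalSpace F (Vertical hp), TangentSpace (𝓘(ℝ, E).prod 𝓘(ℝ, F)) v}

theorem IsSpray.sprayExp_mem_fibre (hS : IsSpray (verticalIncl hp) S)
    (v : TotalSpace F (Vertical hp)) : p (sprayExp S v) = p v.proj :=
  hS.apply_sprayExp (hp.contMDiff.mdifferentiable (by simp)) (fun _ w ↦ w.2) v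

/-- The map `(π, exp)` into the fibre product. -/
def IsSpray.expPair (hS : IsSpray (verticalIncl hp) S) (v : TotalSpace F (Vertical hp)) :
    FibreProduct hp :=
  ⟨(v.proj, sprayExp S v), (hS.sprayExp_mem_fibre v).symm⟩

/-- In charts `(π, exp)` has derivative `(u, w) ↦ (u, u_F + w)` at a zero vector, where `u_F` is the
component of `u` in `F`. -/
theorem IsSpray.exists_partialDiffeomorph_expPair [CompleteSpace E] [T2Space M]
    (hS : IsSpray (verticalIncl hp) S) (m : M) :
    ∃ Θ : PartialDiffeomorph (𝓘(ℝ, E).prod 𝓘(ℝ, F)) 𝓘(ℝ, E × F) (TotalSpace F (Vertical hp))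
        (FibreProduct hp) ∞,
      zeroSection F (Vertical hp) m ∈ Θ.source ∧ Θ.source ⊆ expDomain S ∧
        EqOn hS.expPair Θ Θ.source := by
  have : CompleteSpace F := completeSpace_complement hp m
  let Φ := verticalChart hp m
  have hm : m ∈ (hp m).domChart.source := (hp m).mem_domChart_source
  have hΦm : Φ (zeroSection F (Vertical hp) m) = ((hp m).domChart m, 0) :=
    bundleChart_zeroSection _ hm
  obtain ⟨O, D, hO, hmO, hO_target, hO_dom, h_exp, hD, hD_fst, hD_snd⟩ :=
    hS.exists_contDiffOn_sprayExp (hφ := (hp m).domChart_mem_maximalAtlas)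
      (e := trivializationAt F (Vertical hp) m) ⟨hm, hm⟩
  have hD_apply : ∀ z : E × F, D z = z.1 + (hp m).equiv.symm (0, z.2) := fun z ↦ by
    let v : Vertical hp m := (verticalEquiv hp m hm).symm z.2
    have hv : (trivializationAt F (Vertical hp) m ⟨m, v⟩).2 = z.2 :=
      (verticalEquiv hp m hm).apply_symm_apply z.2
    have h_vertical : D (0, z.2) = (hp m).equiv.symm (0, z.2) :=
      hv ▸ (hD_snd v).trans (mfderiv_domChart_verticalIncl m (v := ⟨m, v⟩) hm)
    rw [← h_vertical, ← hD_fst z.1, ← map_add, Prod.fst_add_snd]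
  let L : E →L[ℝ] F := (ContinuousLinearMap.snd ℝ E' F).comp ((hp m).equiv : E →L[ℝ] E' × F)
  let χ : PartialDiffeomorph 𝓘(ℝ, E × F) 𝓘(ℝ, E × F) (FibreProduct hp) (E × F) ∞ :=
    chartDiffeomorph (IsManifold.chart_mem_maximalAtlas ⟨(m, m), rfl⟩)
  have h_chart : EqOn (χ ∘ hS.expPair ∘ Φ.symm)
      (fun z ↦ (z.1, L ((hp m).domChart (sprayExp S (Φ.symm z))))) O := fun z hz ↦
    Prod.ext (congrArg Prod.fst (Φ.right_inv (hO_target hz)) : _ = z.1) rfl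
  have h_deriv : HasFDerivAt (χ ∘ hS.expPair ∘ Φ.symm) (ContinuousLinearEquiv.skewProd
      (.refl ℝ E) (.refl ℝ F) L : E × F →L[ℝ] E × F) ((hp m).domChart m, 0) := by
    refine ((hasFDerivAt_fst.prodMk (L.hasFDerivAt.comp _ hD)).congr_of_eventuallyEq
      (h_chart.eventuallyEq_of_mem (hO.mem_nhds hmO))).congr_fderiv ?_
    refine ContinuousLinearMap.ext fun z ↦ ?_
    change (z.1, L (D z)) = (z.1, z.2 + L z.1)
    rw [hD_apply, map_add, add_comm]
    change (z.1, ((hp m).equiv ((hp m).equiv.symm (0, z.2))).2 + L z.1) = _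
    rw [ContinuousLinearEquiv.apply_symm_apply]
  obtain ⟨Θ, hmΘ, hΘ_source, hΘ⟩ := exists_partialDiffeomorph_of_hasFDerivAt
    (x := zeroSection F (Vertical hp) m) Φ χ hO ⟨hm, hm⟩ (hΦm ▸ hmO)
    (fun z hz ↦ ⟨(Φ.map_target (hO_target hz)).1, (hO_dom z hz).2⟩)
    ((contDiff_fst.contDiffOn.prodMk (L.contDiff.comp_contDiffOn h_exp)).congr h_chart)
    (hΦm ▸ h_deriv)
  exact ⟨Θ, hmΘ, fun v hv ↦ Φ.left_inv (hΘ_source hv).1 ▸ (hO_dom _ (hΘ_source hv).2).1, hΘ⟩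

theorem IsSpray.exists_isLocalAddition [CompleteSpace E] [T2Space M] [ParacompactSpace M]
    (hS : IsSpray (verticalIncl hp) S) :
    ∃ (U : TopologicalSpace.Opens (TotalSpace F (Vertical hp))) (Ψ : U → FibreProduct hp),
      IsLocalAddition hp U Ψ ∧
      ∀ u : U, (u : TotalSpace F (Vertical hp)) ∈ expDomain S ∧ (Ψ u).snd = sprayExp S u := by
  choose Θ h_zero h_dom h_eq using hS.exists_partialDiffeomorph_expPair
  obtain ⟨U, hU_open, hU_zero, hU_inj, hU⟩ := exists_isOpen_injOn (f := hS.expPair)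
    (FiberBundle.continuous_proj F (Vertical hp))
    (contMDiff_zeroSection (n := ∞) (IB := 𝓘(ℝ, E)) ℝ (Vertical hp)).continuous
    (fun _ ↦ rfl) (fun m ↦ (Θ m).open_source) h_zero
    (fun m ↦ (Θ m).injOn.congr (h_eq m).symm) fun v w h ↦ congrArg FibreProduct.fst h
  let U' : TopologicalSpace.Opens (TotalSpace F (Vertical hp)) := ⟨U, hU_open⟩
  have h_diffeo : IsLocalDiffeomorph (𝓘(ℝ, E).prod 𝓘(ℝ, F)) 𝓘(ℝ, E × F) ∞
      (hS.expPair ∘ (Subtype.val : U' → TotalSpace F (Vertical hp))) := fun u ↦ by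
    obtain ⟨m, hum⟩ := hU u u.2
    exact (isLocalDiffeomorph_subtypeVal U' u).comp _ _ ⟨Θ m, hum, h_eq m⟩
  exact ⟨U', hS.expPair ∘ Subtype.val,
    { zero_mem := hU_zero
      isOpenEmbedding := .of_continuous_injective_isOpenMap h_diffeo.contMDiff.continuous
        hU_inj.injective h_diffeo.isOpenMap
      isLocalDiffeomorph := h_diffeo
      apply_zero := fun m ↦ by
        have : CompleteSpace F := completeSpace_complement hp m
        exact ⟨rfl, hS.sprayExp_zeroSection m⟩
      fst_apply := fun _ ↦ rfl },
    fun u ↦ ⟨(hU u u.2).elim fun m hum ↦ h_dom m hum, rfl⟩⟩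

end Submersion

section AffineInCharts

variable {B B' C C' : Type*} [NormedAddCommGroup B] [NormedSpace ℝ B] [NormedAddCommGroup B']
  [NormedSpace ℝ B'] [NormedAddCommGroup C] [NormedSpace ℝ C] [NormedAddCommGroup C']
  [NormedSpace ℝ C'] {H H' : Type*} [TopologicalSpace H] [TopologicalSpace H']
  {I : ModelWithCorners ℝ B H} {I' : ModelWithCorners ℝ B' H'}
  {X Y : Type*} [TopologicalSpace X] [ChartedSpace H X] [TopologicalSpace Y] [ChartedSpace H' Y]
  {f : X → Y} {Φ : PartialDiffeomorph I 𝓘(ℝ, C) X C ∞} {Ψ : PartialDiffeomorph I' 𝓘(ℝ, C') Y C' ∞}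
  {L : C →L[ℝ] C'} {c : C'} {x : X}

/-- In the charts `Φ` and `Ψ` the map `f` becomes the affine map `z ↦ c + L z`. -/
structure IsAffineInCharts (f : X → Y) (Φ : PartialDiffeomorph I 𝓘(ℝ, C) X C ∞)
    (Ψ : PartialDiffeomorph I' 𝓘(ℝ, C') Y C' ∞) (L : C →L[ℝ] C') (c : C') : Prop where
  mapsTo : MapsTo f Φ.source Ψ.source
  apply_eq : ∀ x ∈ Φ.source, Ψ (f x) = c + L (Φ x)

theorem IsAffineInCharts.contMDiffOn (h : IsAffineInCharts f Φ Ψ L c) :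
    ContMDiffOn I I' ∞ f Φ.source := by
  have h_affine : ContMDiff 𝓘(ℝ, C) 𝓘(ℝ, C') ∞ fun z ↦ c + L z :=
    (contDiff_const.add L.contDiff).contMDiff
  refine (Ψ.symm.contMDiffOn.comp (h_affine.comp_contMDiffOn Φ.contMDiffOn)
    fun x hx ↦ ?_).congr fun x hx ↦ ?_
  · change c + L (Φ x) ∈ Ψ.target
    exact h.apply_eq x hx ▸ Ψ.map_source (h.mapsTo hx)
  · exact (Ψ.left_inv (h.mapsTo hx)).symm.trans (congrArg Ψ.symm (h.apply_eq x hx))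

theorem IsAffineInCharts.mdifferentiableAt (h : IsAffineInCharts f Φ Ψ L c) (hx : x ∈ Φ.source) :
    MDifferentiableAt I I' f x :=
  (h.contMDiffOn.contMDiffAt (Φ.open_source.mem_nhds hx)).mdifferentiableAt (by simp)

theorem IsAffineInCharts.mfderiv_apply (h : IsAffineInCharts f Φ Ψ L c) (hx : x ∈ Φ.source)
    (ξ : TangentSpace I x) :
    mfderiv I' 𝓘(ℝ, C') Ψ (f x) (mfderiv I I' f x ξ) = L (mfderiv I 𝓘(ℝ, C) Φ x ξ) := by
  have h_comp := (Ψ.mdifferentiableAt (by simp) (h.mapsTo hx)).hasMFDerivAt.comp x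
    (h.mdifferentiableAt hx).hasMFDerivAt
  have h_affine := (L.hasFDerivAt.const_add c (x := Φ x)).hasMFDerivAt.comp x
    (Φ.mdifferentiableAt (by simp) hx).hasMFDerivAt
  have h_eq : Ψ ∘ f =ᶠ[𝓝 x] (fun z ↦ c + L z) ∘ Φ :=
    Filter.eventuallyEq_of_mem (Φ.open_source.mem_nhds hx) h.apply_eq
  exact DFunLike.congr_fun (hasMFDerivAt_unique h_comp (h_affine.congr_of_eventuallyEq h_eq)) ξ

theorem IsAffineInCharts.injective_mfderiv (h : IsAffineInCharts f Φ Ψ L c) (hL : Injective L)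
    (hx : x ∈ Φ.source) : Injective (mfderiv I I' f x) := fun ξ η hξη ↦ by
  apply Spray.injective_mfderiv Φ hx
  apply hL
  rw [← h.mfderiv_apply hx, ← h.mfderiv_apply hx, hξη]

variable [IsManifold I ∞ X] {S : ∀ y : Y, TangentSpace I' y}

theorem IsAffineInCharts.exists_related [IsManifold I' ∞ Y] (h : IsAffineInCharts f Φ Ψ L c)
    {P : C' →L[ℝ] C}
    (hS : ContMDiff I' I'.tangent ∞ fun y ↦ (⟨y, S y⟩ : TangentBundle I' Y))
    (hP : ∀ x ∈ Φ.source, L (P (principalPart Ψ S (Ψ (f x)))) = principalPart Ψ S (Ψ (f x))) :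
    ∃ T : ∀ x : X, TangentSpace I x,
      ContMDiffOn I I.tangent ∞ (fun x ↦ (⟨x, T x⟩ : TangentBundle I X)) Φ.source ∧
        ∀ x ∈ Φ.source, mfderiv I I' f x (T x) = S (f x) := by
  let g : X → C := fun x ↦ P (principalPart Ψ S (Ψ (f x)))
  have hg : ContMDiffOn I 𝓘(ℝ, C) ∞ g Φ.source :=
    (P.contDiff.comp_contDiffOn (contDiffOn_principalPart Ψ hS)).contMDiffOn.comp
      (Ψ.contMDiffOn.comp h.contMDiffOn h.mapsTo) fun x hx ↦ Ψ.map_source (h.mapsTo hx)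
  refine ⟨fun x ↦ mfderiv 𝓘(ℝ, C) I Φ.symm (Φ x) (g x), contMDiffOn_mfderiv_symm Φ hg,
    fun x hx ↦ Spray.injective_mfderiv Ψ (h.mapsTo hx) ?_⟩
  refine (h.mfderiv_apply hx _).trans ?_
  exact (congrArg L (mfderiv_mfderiv_symm_apply Φ hx (g x))).trans
    ((hP x hx).trans (principalPart_apply Ψ S (h.mapsTo hx)))

theorem exists_contMDiff_related (hf : ∀ x, Injective (mfderiv I I' f x))
    (h : ∀ x, ∃ U ∈ 𝓝 x, ∃ T : ∀ x : X, TangentSpace I x,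
      ContMDiffOn I I.tangent ∞ (fun x ↦ (⟨x, T x⟩ : TangentBundle I X)) U ∧
        ∀ x ∈ U, mfderiv I I' f x (T x) = S (f x)) :
    ∃ T : ∀ x : X, TangentSpace I x,
      ContMDiff I I.tangent ∞ (fun x ↦ (⟨x, T x⟩ : TangentBundle I X)) ∧
        ∀ x, mfderiv I I' f x (T x) = S (f x) := by
  choose U hU T hT hT_related using h
  have h_related : ∀ x, mfderiv I I' f x (T x x) = S (f x) := fun x ↦
    hT_related x x (mem_of_mem_nhds (hU x))
  refine ⟨fun x ↦ T x x, fun x ↦ ((hT x).contMDiffAt (hU x)).congr_of_eventuallyEq ?_, h_related⟩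
  filter_upwards [hU x] with y hy
  exact congrArg (TotalSpace.mk y) (hf y ((h_related y).trans (hT_related x y hy).symm))

end AffineInCharts

section Fibre

variable {E E' F : Type*} [NormedAddCommGroup E] [NormedSpace ℝ E]
  [NormedAddCommGroup E'] [NormedSpace ℝ E'] [NormedAddCommGroup F] [NormedSpace ℝ F]
  {M N : Type*} [TopologicalSpace M] [ChartedSpace E M] [TopologicalSpace N] [ChartedSpace E' N]
  {p : M → N} (hp : IsSubmersionOfComplement F 𝓘(ℝ, E) 𝓘(ℝ, E') ∞ p) {x : N}

theorem isAffineInCharts_fibreIncl (y : Fibre hp x) :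
    IsAffineInCharts (fibreIncl hp x) (chartDiffeomorph (IsManifold.chart_mem_maximalAtlas y))
      (chartDiffeomorph (hp y.1).domChart_mem_maximalAtlas)
      (((hp y.1).equiv.symm : E' × F →L[ℝ] E).comp (.inr ℝ E' F))
      ((hp y.1).equiv.symm ((hp y.1).codChart x, 0)) where
  mapsTo _ hy' := hy'
  apply_eq y' hy' := by
    have h_fst : ((hp y.1).equiv ((hp y.1).domChart (fibreIncl hp x y'))).1 =
        (hp y.1).codChart x :=
      (submersion_chart_eq (hp y.1) hy').trans (congrArg (hp y.1).codChart y'.2)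
    change (hp y.1).domChart (fibreIncl hp x y') = (hp y.1).equiv.symm ((hp y.1).codChart x, 0) +
      (hp y.1).equiv.symm (0, chartAt F y y')
    rw [← map_add, ContinuousLinearEquiv.eq_symm_apply, Prod.mk_add_mk, add_zero, zero_add]
    exact Prod.ext h_fst rfl

theorem injective_mfderiv_fibreIncl (y : Fibre hp x) :
    Injective (mfderiv 𝓘(ℝ, F) 𝓘(ℝ, E) (fibreIncl hp x) y) :=
  (isAffineInCharts_fibreIncl hp y).injective_mfderiv
    ((hp y.1).equiv.symm.injective.comp (Prod.mk_right_injective 0)) (mem_chart_source F y)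

/-- The chart of the tangent bundle of a fibre induced by the chart around `y`. -/
abbrev fibreTangentChart (y : Fibre hp x) :
    PartialDiffeomorph (𝓘(ℝ, F).prod 𝓘(ℝ, F)) 𝓘(ℝ, F × F)
      (TotalSpace F (TangentSpace 𝓘(ℝ, F) : Fibre hp x → Type _)) (F × F) ∞ :=
  bundleChart (IsManifold.chart_mem_maximalAtlas y)
    (trivializationAt F (TangentSpace 𝓘(ℝ, F)) y)

theorem mem_fibreTangentChart_source
    (v : TotalSpace F (TangentSpace 𝓘(ℝ, F) : Fibre hp x → Type _)) :
    v ∈ (fibreTangentChart hp v.proj).source :=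
  ⟨mem_chart_source F v.proj, mem_chart_source F v.proj⟩

/-- The linear part of the tangent map of the inclusion of a fibre in charts. -/
def fibreTangentLinear (y : Fibre hp x) : F × F →L[ℝ] E × F :=
  (((hp y.1).equiv.symm : E' × F →L[ℝ] E).comp (.inr ℝ E' F)).prodMap (.id ℝ F)

theorem isAffineInCharts_fibreTangentIncl (y : Fibre hp x) :
    IsAffineInCharts (fibreTangentIncl hp x) (fibreTangentChart hp y) (verticalChart hp y.1)
      (fibreTangentLinear hp y) ((hp y.1).equiv.symm ((hp y.1).codChart x, 0), 0) where
  mapsTo _ hv := ⟨hv.1, hv.1⟩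
  apply_eq v hv := by
    have h_coord : (trivializationAt F (TangentSpace 𝓘(ℝ, F)) y v).2 =
        mfderiv 𝓘(ℝ, F) 𝓘(ℝ, F) (chartAt F y) v.proj v.2 := by
      have h := DFunLike.congr_fun
        (TangentBundle.continuousLinearMapAt_trivializationAt (I := 𝓘(ℝ, F)) hv.1) v.2
      rwa [Trivialization.continuousLinearMapAt_apply,
        Trivialization.coe_linearMapAt_of_mem _ hv.2] at h
    refine Prod.ext ((isAffineInCharts_fibreIncl hp y).apply_eq v.proj hv.1) ?_
    refine Eq.trans (congrArg (fun z ↦ ((hp y.1).equiv z).2)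
      ((isAffineInCharts_fibreIncl hp y).mfderiv_apply hv.1 v.2)) ?_
    change ((hp y.1).equiv ((hp y.1).equiv.symm (0, _))).2 = 0 + _
    rw [ContinuousLinearEquiv.apply_symm_apply, zero_add]
    exact h_coord.symm

theorem fibreTangentIncl_bundleScale (a : ℝ)
    (v : TotalSpace F (TangentSpace 𝓘(ℝ, F) : Fibre hp x → Type _)) :
    fibreTangentIncl hp x (bundleScale a v) = bundleScale a (fibreTangentIncl hp x v) :=
  congrArg (TotalSpace.mk _) (Subtype.ext
    (map_smul (mfderiv 𝓘(ℝ, F) 𝓘(ℝ, E) (fibreIncl hp x) v.proj) a v.2))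

theorem mdifferentiable_fibreTangentIncl :
    MDifferentiable (𝓘(ℝ, F).prod 𝓘(ℝ, F)) (𝓘(ℝ, E).prod 𝓘(ℝ, F)) (fibreTangentIncl hp x) :=
  fun v ↦ (isAffineInCharts_fibreTangentIncl hp v.proj).mdifferentiableAt
    (mem_fibreTangentChart_source hp v)

theorem injective_mfderiv_fibreTangentIncl
    (v : TotalSpace F (TangentSpace 𝓘(ℝ, F) : Fibre hp x → Type _)) :
    Injective (mfderiv (𝓘(ℝ, F).prod 𝓘(ℝ, F)) (𝓘(ℝ, E).prod 𝓘(ℝ, F)) (fibreTangentIncl hp x) v) :=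
  (isAffineInCharts_fibreTangentIncl hp v.proj).injective_mfderiv
    (((hp v.proj.1).equiv.symm.injective.comp (Prod.mk_right_injective 0)).prodMap injective_id)
    (mem_fibreTangentChart_source hp v)

theorem mfderiv_fibreTangentIncl_bundleScale (a : ℝ)
    (v : TotalSpace F (TangentSpace 𝓘(ℝ, F) : Fibre hp x → Type _))
    (ξ : TangentSpace (𝓘(ℝ, F).prod 𝓘(ℝ, F)) v) :
    (mfderiv (𝓘(ℝ, F).prod 𝓘(ℝ, F)) (𝓘(ℝ, E).prod 𝓘(ℝ, F)) (fibreTangentIncl hp x)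
      (bundleScale a v) (mfderiv (𝓘(ℝ, F).prod 𝓘(ℝ, F)) (𝓘(ℝ, F).prod 𝓘(ℝ, F))
        (bundleScale a) v ξ) : E × F) =
      mfderiv (𝓘(ℝ, E).prod 𝓘(ℝ, F)) (𝓘(ℝ, E).prod 𝓘(ℝ, F)) (bundleScale a)
        (fibreTangentIncl hp x v) (mfderiv (𝓘(ℝ, F).prod 𝓘(ℝ, F)) (𝓘(ℝ, E).prod 𝓘(ℝ, F))
          (fibreTangentIncl hp x) v ξ) := by
  have h_incl := (mdifferentiable_fibreTangentIncl hp (bundleScale a v)).hasMFDerivAt.comp v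
    (mdifferentiable_bundleScale a v).hasMFDerivAt
  have h_scale := (mdifferentiable_bundleScale a (fibreTangentIncl hp x v)).hasMFDerivAt.comp v
    (mdifferentiable_fibreTangentIncl hp v).hasMFDerivAt
  rw [show fibreTangentIncl hp x ∘ bundleScale a = bundleScale a ∘ fibreTangentIncl hp x from
    funext (fibreTangentIncl_bundleScale hp a)] at h_incl
  exact DFunLike.congr_fun (hasMFDerivAt_unique h_incl h_scale) ξ

variable [IsManifold 𝓘(ℝ, E) ∞ M] {hp}
  {S : ∀ v : TotalSpace F (Vertical hp), TangentSpace (𝓘(ℝ, E).prod 𝓘(ℝ, F)) v}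
  {T : ∀ v : TotalSpace F (TangentSpace 𝓘(ℝ, F) : Fibre hp x → Type _),
    TangentSpace (𝓘(ℝ, F).prod 𝓘(ℝ, F)) v}

theorem IsSpray.exists_related (hS : IsSpray (verticalIncl hp) S) (x : N) :
    ∃ T : ∀ v : TotalSpace F (TangentSpace 𝓘(ℝ, F) : Fibre hp x → Type _),
        TangentSpace (𝓘(ℝ, F).prod 𝓘(ℝ, F)) v,
      ContMDiff (𝓘(ℝ, F).prod 𝓘(ℝ, F)) (𝓘(ℝ, F).prod 𝓘(ℝ, F)).tangent ∞
        (fun v ↦ (⟨v, T v⟩ : TangentBundle (𝓘(ℝ, F).prod 𝓘(ℝ, F))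
          (TotalSpace F (TangentSpace 𝓘(ℝ, F) : Fibre hp x → Type _)))) ∧
        ∀ v, mfderiv (𝓘(ℝ, F).prod 𝓘(ℝ, F)) (𝓘(ℝ, E).prod 𝓘(ℝ, F)) (fibreTangentIncl hp x) v
          (T v) = S (fibreTangentIncl hp x v) := by
  refine exists_contMDiff_related (injective_mfderiv_fibreTangentIncl hp) fun v₀ ↦
    ⟨_, (fibreTangentChart hp v₀.proj).open_source.mem_nhds (mem_fibreTangentChart_source hp v₀),
      (isAffineInCharts_fibreTangentIncl hp v₀.proj).exists_related hS.contMDiff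
        (P := ((ContinuousLinearMap.snd ℝ E' F).comp
          ((hp v₀.proj.1).equiv : E →L[ℝ] E' × F)).prodMap (.id ℝ F)) fun v hv ↦ ?_⟩
  have h_fst := (hS.fst_principalPart (hφ := (hp v₀.proj.1).domChart_mem_maximalAtlas)
    ((isAffineInCharts_fibreTangentIncl hp v₀.proj).mapsTo hv)).trans
      (mfderiv_domChart_verticalIncl v₀.proj.1 (v := fibreTangentIncl hp x v) hv.1)
  refine Prod.ext ?_ rfl
  change (hp v₀.proj.1).equiv.symm (0, ((hp v₀.proj.1).equiv
    (principalPart (verticalChart hp v₀.proj.1) S _).1).2) = _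
  rw [h_fst, ContinuousLinearEquiv.apply_symm_apply]

theorem IsSpray.mfderiv_proj_of_related (hS : IsSpray (verticalIncl hp) S)
    {v : TotalSpace F (TangentSpace 𝓘(ℝ, F) : Fibre hp x → Type _)}
    {ξ : TangentSpace (𝓘(ℝ, F).prod 𝓘(ℝ, F)) v}
    (hξ : mfderiv (𝓘(ℝ, F).prod 𝓘(ℝ, F)) (𝓘(ℝ, E).prod 𝓘(ℝ, F)) (fibreTangentIncl hp x) v ξ =
      S (fibreTangentIncl hp x v)) :
    mfderiv (𝓘(ℝ, F).prod 𝓘(ℝ, F)) 𝓘(ℝ, F) (π F (TangentSpace 𝓘(ℝ, F))) v ξ = v.2 := by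
  apply injective_mfderiv_fibreIncl hp v.proj
  have h_base := ((contMDiff_fibreIncl hp x).mdifferentiable (by simp) v.proj).hasMFDerivAt.comp v
    ((contMDiff_proj (n := ∞) (IB := 𝓘(ℝ, F)) (F := F)
      (TangentSpace 𝓘(ℝ, F) : Fibre hp x → Type _)).mdifferentiable (by simp) v).hasMFDerivAt
  have h_total := ((contMDiff_proj (n := ∞) (IB := 𝓘(ℝ, E)) (F := F)
    (Vertical hp)).mdifferentiable (by simp) (fibreTangentIncl hp x v)).hasMFDerivAt.comp v
      (mdifferentiable_fibreTangentIncl hp v).hasMFDerivAt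
  refine (DFunLike.congr_fun (hasMFDerivAt_unique h_base h_total) ξ).trans ?_
  exact (congrArg (mfderiv (𝓘(ℝ, E).prod 𝓘(ℝ, F)) 𝓘(ℝ, E) (π F (Vertical hp))
    (fibreTangentIncl hp x v)) hξ).trans (hS.lifts_anchor _)

theorem IsSpray.isSpray_of_related (hS : IsSpray (verticalIncl hp) S)
    (hT : ContMDiff (𝓘(ℝ, F).prod 𝓘(ℝ, F)) (𝓘(ℝ, F).prod 𝓘(ℝ, F)).tangent ∞
      (fun v ↦ (⟨v, T v⟩ : TangentBundle (𝓘(ℝ, F).prod 𝓘(ℝ, F))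
        (TotalSpace F (TangentSpace 𝓘(ℝ, F) : Fibre hp x → Type _)))))
    (h_related : ∀ v, mfderiv (𝓘(ℝ, F).prod 𝓘(ℝ, F)) (𝓘(ℝ, E).prod 𝓘(ℝ, F))
      (fibreTangentIncl hp x) v (T v) = S (fibreTangentIncl hp x v)) :
    IsSpray (fun y : Fibre hp x ↦ ContinuousLinearMap.id ℝ (TangentSpace 𝓘(ℝ, F) y)) T where
  contMDiff := hT
  lifts_anchor v := hS.mfderiv_proj_of_related (h_related v)
  homogeneous a v := by
    apply injective_mfderiv_fibreTangentIncl hp (bundleScale a v)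
    have h_scale : (S (fibreTangentIncl hp x (bundleScale a v)) : E × F) =
        S (bundleScale a (fibreTangentIncl hp x v)) :=
      congrArg (fun w ↦ (S w : E × F)) (fibreTangentIncl_bundleScale hp a v)
    refine ((h_related _).trans (h_scale.trans (hS.homogeneous a _))).trans ?_
    refine Eq.trans ?_ (mfderiv_fibreTangentIncl_bundleScale hp a v (a • T v)).symm
    exact congrArg (mfderiv (𝓘(ℝ, E).prod 𝓘(ℝ, F)) (𝓘(ℝ, E).prod 𝓘(ℝ, F)) (bundleScale a)
      (fibreTangentIncl hp x v)) ((map_smul _ a (T v)).trans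
        (congrArg (fun ξ : E × F ↦ a • ξ) (h_related v))).symm

theorem IsSpray.existsUnique_restrict (hS : IsSpray (verticalIncl hp) S) (x : N) :
    ∃! T : ∀ v : TotalSpace F (TangentSpace 𝓘(ℝ, F) : Fibre hp x → Type _),
        TangentSpace (𝓘(ℝ, F).prod 𝓘(ℝ, F)) v,
      IsSpray (fun y ↦ ContinuousLinearMap.id ℝ (TangentSpace 𝓘(ℝ, F) y)) T ∧
      ∀ v, mfderiv (𝓘(ℝ, F).prod 𝓘(ℝ, F)) (𝓘(ℝ, E).prod 𝓘(ℝ, F))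
        (fibreTangentIncl hp x) v (T v) = S (fibreTangentIncl hp x v) := by
  obtain ⟨T, hT, h_related⟩ := hS.exists_related x
  refine ⟨T, ⟨hS.isSpray_of_related hT h_related, h_related⟩, fun T' hT' ↦ funext fun v ↦ ?_⟩
  exact injective_mfderiv_fibreTangentIncl hp v ((hT'.2 v).trans (h_related v).symm)

end Fibre

end Spray

end

theorem mainTheorem5_general {E E' F : Type*}
    [NormedAddCommGroup E] [NormedSpace ℝ E] [CompleteSpace E]
    [NormedAddCommGroup E'] [NormedSpace ℝ E']
    [NormedAddCommGroup F] [NormedSpace ℝ F]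
    {M N : Type*}
    [TopologicalSpace M] [T2Space M] [ChartedSpace E M] [IsManifold 𝓘(ℝ, E) ∞ M]
    [TopologicalSpace N] [ChartedSpace E' N] [IsManifold 𝓘(ℝ, E') ∞ N]
    (p : M → N) (hp : IsSubmersionOfComplement F 𝓘(ℝ, E) 𝓘(ℝ, E') ∞ p) :
    (∀ S : ∀ v : TotalSpace F (Spray.Vertical hp), TangentSpace (𝓘(ℝ, E).prod 𝓘(ℝ, F)) v,
      Spray.IsSpray (Spray.verticalIncl hp) S →
      ∀ x : N, ∃! Sx : ∀ v : TotalSpace F (TangentSpace 𝓘(ℝ, F) : Spray.Fibre hp x → Type _),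
          TangentSpace (𝓘(ℝ, F).prod 𝓘(ℝ, F)) v,
        Spray.IsSpray (fun y ↦ ContinuousLinearMap.id ℝ (TangentSpace 𝓘(ℝ, F) y)) Sx ∧
        ∀ v, mfderiv (𝓘(ℝ, F).prod 𝓘(ℝ, F)) (𝓘(ℝ, E).prod 𝓘(ℝ, F))
          (Spray.fibreTangentIncl hp x) v (Sx v) = S (Spray.fibreTangentIncl hp x v)) ∧
    (Spray.SmoothlyParacompact E M →
      ∃ S : ∀ v : TotalSpace F (Spray.Vertical hp), TangentSpace (𝓘(ℝ, E).prod 𝓘(ℝ, F)) v,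
        Spray.IsSpray (Spray.verticalIncl hp) S) ∧
    (ParacompactSpace M →
      ∀ S : ∀ v : TotalSpace F (Spray.Vertical hp), TangentSpace (𝓘(ℝ, E).prod 𝓘(ℝ, F)) v,
        Spray.IsSpray (Spray.verticalIncl hp) S →
        ∃ (U : TopologicalSpace.Opens (TotalSpace F (Spray.Vertical hp)))
          (Ψ : U → Spray.FibreProduct hp),
          Spray.IsLocalAddition hp U Ψ ∧
          ∀ u : U, (u : TotalSpace F (Spray.Vertical hp)) ∈ Spray.expDomain S ∧
            (Ψ u).snd = Spray.sprayExp S u) :=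
  ⟨fun _ hS ↦ hS.existsUnique_restrict,
    fun hM ↦ Spray.exists_isSpray hM (Spray.contMDiff_verticalIncl hp),
    fun _ _ hS ↦ hS.exists_isLocalAddition⟩

theorem mainTheorem5 {E E' F : Type*}
    [NormedAddCommGroup E] [NormedSpace ℝ E] [CompleteSpace E]
    [NormedAddCommGroup E'] [NormedSpace ℝ E'] [CompleteSpace E']
    [NormedAddCommGroup F] [NormedSpace ℝ F]
    {M N : Type*}
    [TopologicalSpace M] [T2Space M] [ChartedSpace E M] [IsManifold 𝓘(ℝ, E) ∞ M]
    [TopologicalSpace N] [T2Space N] [ChartedSpace E' N] [IsManifold 𝓘(ℝ, E') ∞ N]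
    (p : M → N) (hp : IsSubmersionOfComplement F 𝓘(ℝ, E) 𝓘(ℝ, E') ∞ p)
    (hsurj : Function.Surjective p) :
    (∀ S : ∀ v : TotalSpace F (Spray.Vertical hp), TangentSpace (𝓘(ℝ, E).prod 𝓘(ℝ, F)) v,
      Spray.IsSpray (Spray.verticalIncl hp) S →
      ∀ x : N, ∃! Sx : ∀ v : TotalSpace F (TangentSpace 𝓘(ℝ, F) : Spray.Fibre hp x → Type _),
          TangentSpace (𝓘(ℝ, F).prod 𝓘(ℝ, F)) v,
        Spray.IsSpray (fun y ↦ ContinuousLinearMap.id ℝ (TangentSpace 𝓘(ℝ, F) y)) Sx ∧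
        ∀ v, mfderiv (𝓘(ℝ, F).prod 𝓘(ℝ, F)) (𝓘(ℝ, E).prod 𝓘(ℝ, F))
          (Spray.fibreTangentIncl hp x) v (Sx v) = S (Spray.fibreTangentIncl hp x v)) ∧
    (Spray.SmoothlyParacompact E M →
      (∃ S : ∀ v : TotalSpace F (Spray.Vertical hp), TangentSpace (𝓘(ℝ, E).prod 𝓘(ℝ, F)) v,
        Spray.IsSpray (Spray.verticalIncl hp) S) ∧
      ∀ S : ∀ v : TotalSpace F (Spray.Vertical hp), TangentSpace (𝓘(ℝ, E).prod 𝓘(ℝ, F)) v,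
        Spray.IsSpray (Spray.verticalIncl hp) S →
        ∃ (U : TopologicalSpace.Opens (TotalSpace F (Spray.Vertical hp)))
          (Ψ : U → Spray.FibreProduct hp),
          Spray.IsLocalAddition hp U Ψ ∧
          ∀ u : U, (u : TotalSpace F (Spray.Vertical hp)) ∈ Spray.expDomain S ∧
            (Ψ u).snd = Spray.sprayExp S u) := by
  obtain ⟨h_restrict, h_exists, h_addition⟩ := mainTheorem5_general p hp
  exact ⟨h_restrict, fun hM ↦ ⟨h_exists hM, h_addition hM.1⟩⟩
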